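/- For $n\ge 0$ let $a_n=\frac{1}{4^n}\binom{2n}{n}$. For finite (possibly empty) sequences of positive integers $\mathbf k=(k_1,\dots,k_d)$ and $\mathbf l=(l_1,\dots,l_e)$ put $|\mathbf k|=k_1+\cdots+k_d$, $|\mathbf l|=l_1+\cdots+l_e$ and $$\zeta_n(\mathbf k)=\sum_{n\ge m_1>\cdots>m_d>0}\frac{1}{m_1^{k_1}\cdots m_d^{k_d}},\qquad t_n(\mathbf l)=\sum_{n\ge r_1>\cdots>r_e>0}\frac{1}{(2r_1-1)^{l_1}\cdots(2r_e-1)^{l_e}},$$ with $\zeta_n(\emptyset)=t_n(\emptyset)=1$. For $w\ge 0$ let $\mathrm{CMZV}^4_w\subset\mathbb C$ be the $\mathbb Q$-linear span of the colored multiple zeta values of level $4$ and weight $w$, that is, of the values $$\mathrm{Li}_{s_1,\dots,s_r}(z_1,\dots,z_r)=\sum_{n_1>\cdots>n_r>0}\frac{z_1^{n_1}\cdots z_r^{n_r}}{n_1^{s_1}\cdots n_r^{s_r}}=\lim_{N\to\infty}\ \sum_{N>n_1>\cdots>n_r>0}\frac{z_1^{n_1}\cdots z_r^{n_r}}{n_1^{s_1}\cdots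 n_r^{s_r}},$$ where $s_1,\dots,s_r$ are positive integers with $s_1+\cdots+s_r=w$, $z_1,\dots,z_r\in\mathbb C$ satisfy $z_j^4=1$, and $(s_1,z_1)\ne(1,1)$ (for $r=0$ the value is $1$, of weight $0$). Then for all integers $p\ge 2$ and $q\ge 3$ and all finite sequences of positive integers $\mathbf k$ and $\mathbf l$ (including $\mathbf k=\emptyset$ or $\mathbf l=\emptyset$), the following series converge and (a) $\displaystyle\sum_{n=1}^\infty a_n\frac{\zeta_n(\mathbf k)\,t_n(\mathbf l)}{n^p}\in \mathrm{CMZV}^4_{|\mathbf k|+|\mathbf l|+p}$; (b) $\displaystyle\sum_{n=1}^\infty a_n^2\,\frac{\zeta_n(\mathbf k)\,t_n(\mathbf l)}{n^q}\in \frac{i}{\pi}\,\mathrm{CMZV}^4_{|\mathbf k|+|\mathbf l|+q+1}$; (c) $\displaystyle\sum_{n=0}^\infty a_n\frac{\zeta_n(\mathbf k)\,t_n(\mathbf l)}{(2n+1)^p}\in i\,\mathrm{CMZV}^4_{|\mathbf k|+|\mathbf l|+p}$; (d) $\displaystyle\sum_{n=0}^\infty a_n^2\,\frac{\zeta_n(\mathbf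 k)\,t_n(\mathbf l)}{(2n+1)^q}\in \frac{i}{\pi}\,\mathrm{CMZV}^4_{|\mathbf k|+|\mathbf l|+q+1}$. -/

import Mathlib

/-- The sum of `f₁ n₁ * ⋯ * f_d n_d` over all integers `N > n₁ > ⋯ > n_d > 0`;
it is `1` for `d = 0`. -/
def nestedSum {R : Type*} [CommSemiring R] : List (ℕ → R) → ℕ → R
  | [], _ => 1
  | f :: fs, N => ∑ n ∈ Finset.Ico 1 N, f n * nestedSum fs n

/-- `ζ_n(k₁, …, k_d)`, the sum of `1 / (m₁ ^ k₁ ⋯ m_d ^ k_d)` over `n ≥ m₁ > ⋯ > m_d > 0`. -/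
noncomputable def zetaSum (k : List ℕ) (n : ℕ) : ℝ :=
  nestedSum (k.map fun s m => 1 / (m : ℝ) ^ s) (n + 1)

/-- `t_n(l₁, …, l_e)`, the sum of `1 / ((2r₁ - 1) ^ l₁ ⋯ (2r_e - 1) ^ l_e)` over
`n ≥ r₁ > ⋯ > r_e > 0`. -/
noncomputable def tSum (l : List ℕ) (n : ℕ) : ℝ :=
  nestedSum (l.map fun s r => 1 / (2 * (r : ℝ) - 1) ^ s) (n + 1)

/-- `a_n = binom(2n, n) / 4 ^ n`. -/
noncomputable def aCoeff (n : ℕ) : ℝ := (Nat.centralBinom n : ℝ) / 4 ^ n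

/-- For `L = [(s₁, z₁), …, (s_d, z_d)]`, the truncation to `n₁ < N` of the series
`Li_{s₁, …, s_d}(z₁, …, z_d)`, whose terms `z₁ ^ n₁ ⋯ z_d ^ n_d / (n₁ ^ s₁ ⋯ n_d ^ s_d)` are
indexed by `n₁ > ⋯ > n_d > 0`. -/
noncomputable def liPartial (L : List (ℕ × ℂ)) (N : ℕ) : ℂ :=
  nestedSum (L.map fun p n => p.2 ^ n / (n : ℂ) ^ p.1) N

/-- `x` is a colored multiple zeta value of level `N` and weight `w`: the sum of the convergent
series `Li_{s₁, …, s_d}(z₁, …, z_d)`, where the `s_j` are positive integers with sum `w`, the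
`z_j` are `N`-th roots of unity, and `(s₁, z₁) ≠ (1, 1)`. For `d = 0` the value is `1`,
of weight `0`. -/
def IsColoredMZV (N w : ℕ) (x : ℂ) : Prop :=
  ∃ L : List (ℕ × ℂ), (∀ p ∈ L, 0 < p.1 ∧ p.2 ^ N = 1) ∧ L.head? ≠ some (1, 1) ∧
    (L.map Prod.fst).sum = w ∧ Filter.Tendsto (liPartial L) Filter.atTop (nhds x)

/-- The `ℚ`-linear span of the colored multiple zeta values of level `N` and weight `w`. -/
noncomputable def CMZV (N w : ℕ) : Submodule ℚ ℂ := Submodule.span ℚ {x | IsColoredMZV N w x}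

/-! Substitute x = sin θ = 2u/(1+u²) with u = tan(θ/2). Then √(1-x²) = (1-u²)/(1+u²), dx/x = du/u -
2u du/(1+u²) and dθ = dx/√(1-x²) = 2du/(1+u²). All forms that occur are rational combinations of
du/u and z du/(1-zu) with z⁴ = 1, up to a factor i, so iterated integrals of them are level four
polylogarithms in u, and u = 1 corresponds to x = 1.

Let c_n = ζ_n(k) t_n(l) and F = ∑ a_n c_n x^(2n). The core claim (`isBinomialPolylog_mul_and_sum`)
is that √(1-x²) F is such a polylogarithm, of weight |k|+|l|. The recurrence 2(n+1)a_{n+1} =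
(2n+1)a_n gives a first-order equation for F with integrating factor √(1-x²). Hence the u-derivative
of √(1-x²) F is (1/u) ∑ 2n a_n (c_n - c_{n-1}) x^(2n) (`hasDerivAt_cosParam_mul`), so prepending an
outer summation to c is one more iterated integration.

Dividing the terms of F by powers of n or 2n+1 means integrating against dx/x. The results
(`IsBinomialPolylog.even_tail`, `IsBinomialPolylog.odd_tail`) lie in the span of words convergent at
u = 1, and Abel's theorem at u = 1 gives (a) and (c); the i in (c) comes from dθ. For (b) and (d)
the second factor a_n and the 1/π come from integrating once more in θ, since ∫₀^{π/2} sin^(2n) θ dθ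
= (π/2) a_n. Nonnegativity of the terms yields convergence of the series at the endpoint. -/

/-- The sequence `d` grows at most polynomially. -/
def PolyGrowth (d : ℕ → ℂ) : Prop := ∃ (C : ℝ) (k : ℕ), 0 ≤ C ∧ ∀ n, ‖d n‖ ≤ C * ((n : ℝ) + 1) ^ k

/-- The sum of the power series with coefficients `d` at a real point. -/
noncomputable def powerSum (d : ℕ → ℂ) (u : ℝ) : ℂ := ∑' n, d n * (u : ℂ) ^ n

/-! ### Polynomially bounded coefficient sequences -/

namespace PolyGrowth

variable {d e : ℕ → ℂ}

theorem of_norm_le (hd : PolyGrowth d) (h : ∀ n, ‖e n‖ ≤ ‖d n‖) : PolyGrowth e := by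
  obtain ⟨C, k, hC, H⟩ := hd
  exact ⟨C, k, hC, fun n => (h n).trans (H n)⟩

theorem mul (hd : PolyGrowth d) (he : PolyGrowth e) : PolyGrowth (fun n => d n * e n) := by
  obtain ⟨C, k, hC, H⟩ := hd
  obtain ⟨C', k', hC', H'⟩ := he
  refine ⟨C * C', k + k', by positivity, fun n => ?_⟩
  rw [norm_mul]
  calc ‖d n‖ * ‖e n‖ ≤ (C * ((n : ℝ) + 1) ^ k) * (C' * ((n : ℝ) + 1) ^ k') := by
        gcongr
        · exact H n
        · exact H' n
    _ = _ := by ring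

theorem add (hd : PolyGrowth d) (he : PolyGrowth e) : PolyGrowth (fun n => d n + e n) := by
  obtain ⟨C, k, hC, H⟩ := hd
  obtain ⟨C', k', hC', H'⟩ := he
  refine ⟨C + C', k + k', by positivity, fun n => (norm_add_le _ _).trans ?_⟩
  have h1 : (1 : ℝ) ≤ (n : ℝ) + 1 := by linarith [n.cast_nonneg (α := ℝ)]
  calc ‖d n‖ + ‖e n‖ ≤ C * ((n : ℝ) + 1) ^ k + C' * ((n : ℝ) + 1) ^ k' := add_le_add (H n) (H' n)
    _ ≤ C * ((n : ℝ) + 1) ^ (k + k') + C' * ((n : ℝ) + 1) ^ (k + k') := by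
        gcongr <;> first | exact h1 | omega
    _ = _ := by ring

theorem const (a : ℂ) : PolyGrowth (fun _ => a) :=
  ⟨‖a‖, 0, norm_nonneg _, fun n => by simp⟩

theorem natCast : PolyGrowth (fun n => (n : ℂ)) :=
  ⟨1, 1, zero_le_one, fun n => by simp⟩

theorem const_mul (a : ℂ) (hd : PolyGrowth d) : PolyGrowth (fun n => a * d n) := (const a).mul hd

theorem natCast_mul (hd : PolyGrowth d) : PolyGrowth (fun n => n * d n) := natCast.mul hd

theorem sub (hd : PolyGrowth d) (he : PolyGrowth e) : PolyGrowth (fun n => d n - e n) := by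
  simpa [sub_eq_add_neg] using hd.add (he.const_mul (-1))

theorem div_natCast_pow (hd : PolyGrowth d) (s : ℕ) : PolyGrowth (fun n => d n / (n : ℂ) ^ s) := by
  refine hd.of_norm_le fun n => ?_
  rw [norm_div, norm_pow, Complex.norm_natCast]
  rcases n.eq_zero_or_pos with rfl | hn
  · rcases s.eq_zero_or_pos with rfl | hs
    · simp
    · simp [hs.ne']
  · exact div_le_self (norm_nonneg _) (one_le_pow₀ (by exact_mod_cast hn))

theorem div_odd_pow (hd : PolyGrowth d) (s : ℕ) :
    PolyGrowth (fun n => d n / (2 * (n : ℂ) + 1) ^ s) := by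
  refine hd.of_norm_le fun n => ?_
  have : (2 * (n : ℂ) + 1) = ((2 * n + 1 : ℕ) : ℂ) := by push_cast; ring
  rw [norm_div, norm_pow, this, Complex.norm_natCast]
  exact div_le_self (norm_nonneg _) (one_le_pow₀ (by exact_mod_cast Nat.le_add_left 1 _))

theorem sum_range (hd : PolyGrowth d) : PolyGrowth (fun n => ∑ m ∈ Finset.range n, d m) := by
  obtain ⟨C, k, hC, H⟩ := hd
  refine ⟨C, k + 1, hC, fun n => ?_⟩
  calc ‖∑ m ∈ Finset.range n, d m‖ ≤ ∑ m ∈ Finset.range n, C * ((n : ℝ) + 1) ^ k := by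
        refine norm_sum_le_of_le _ fun m hm => (H m).trans ?_
        have : (m : ℝ) ≤ n := by exact_mod_cast (Finset.mem_range.1 hm).le
        gcongr
    _ = C * ((n : ℝ) + 1) ^ k * n := by simp; ring
    _ ≤ C * ((n : ℝ) + 1) ^ k * (n + 1) := by gcongr; linarith
    _ = _ := by ring

theorem succ (hd : PolyGrowth d) : PolyGrowth (fun n => d (n + 1)) := by
  obtain ⟨C, k, hC, H⟩ := hd
  refine ⟨C * 2 ^ k, k, by positivity, fun n => (H (n + 1)).trans ?_⟩
  rw [mul_assoc, ← mul_pow]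
  have : (0 : ℝ) ≤ n := n.cast_nonneg
  gcongr
  push_cast
  linarith

theorem of_succ (hd : PolyGrowth fun n => d (n + 1)) : PolyGrowth d := by
  obtain ⟨C, k, hC, H⟩ := hd
  refine ⟨C + ‖d 0‖, k, by positivity, fun n => ?_⟩
  have h1 : (1 : ℝ) ≤ (n : ℝ) + 1 := by linarith [n.cast_nonneg (α := ℝ)]
  rcases n with _ | n
  · simpa using hC
  · refine (H n).trans ?_
    have := norm_nonneg (d 0)
    gcongr <;> linarith

theorem summable_norm (hd : PolyGrowth d) {u : ℝ} (hu : |u| < 1) :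
    Summable fun n => ‖d n * (u : ℂ) ^ n‖ := by
  obtain ⟨C, k, hC, H⟩ := hd
  refine summable_norm_mul_geometric_of_norm_lt_one' (k := k) (by simpa using hu) ?_
  refine Asymptotics.IsBigO.of_bound (C * 2 ^ k) ?_
  filter_upwards [Filter.eventually_ge_atTop 1] with n hn
  refine (H n).trans ?_
  have h1 : (1 : ℝ) ≤ n := by exact_mod_cast hn
  rw [mul_assoc]
  simp only [Nat.cast_pow, norm_pow, RCLike.norm_natCast]
  rw [← mul_pow]
  gcongr
  linarith

theorem hasSum (hd : PolyGrowth d) {u : ℝ} (hu : |u| < 1) :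
    HasSum (fun n => d n * (u : ℂ) ^ n) (powerSum d u) :=
  (hd.summable_norm hu).of_norm.hasSum

end PolyGrowth

/-! ### Calculus of power series on the unit interval -/

section powerSum

variable {d e : ℕ → ℂ} {u : ℝ}

theorem powerSum_add (hd : PolyGrowth d) (he : PolyGrowth e) (hu : |u| < 1) :
    powerSum (fun n => d n + e n) u = powerSum d u + powerSum e u := by
  rw [← ((hd.hasSum hu).add (he.hasSum hu)).tsum_eq]
  simp only [powerSum, add_mul]

theorem powerSum_const_mul (a : ℂ) (d : ℕ → ℂ) (u : ℝ) :
    powerSum (fun n => a * d n) u = a * powerSum d u := by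
  simp only [powerSum, mul_assoc, tsum_mul_left]

theorem powerSum_sub (hd : PolyGrowth d) (he : PolyGrowth e) (hu : |u| < 1) :
    powerSum (fun n => d n - e n) u = powerSum d u - powerSum e u := by
  rw [← ((hd.hasSum hu).sub (he.hasSum hu)).tsum_eq]
  simp only [powerSum, sub_mul]

theorem powerSum_zero (d : ℕ → ℂ) : powerSum d 0 = d 0 := by
  rw [powerSum, tsum_eq_single 0]
  · simp
  · intro n hn
    simp [hn]

theorem powerSum_eq_add (hd : PolyGrowth d) (hu : |u| < 1) :
    powerSum d u = d 0 + u * powerSum (fun n => d (n + 1)) u := by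
  rw [powerSum, (hd.hasSum hu).summable.tsum_eq_zero_add, powerSum, ← tsum_mul_left]
  simp only [pow_zero, mul_one, pow_succ]
  congr 1
  refine tsum_congr fun n => by ring

theorem hasDerivAt_powerSum (hd : PolyGrowth d) (hu : |u| < 1) :
    HasDerivAt (powerSum d) (powerSum (fun n => ((n + 1 : ℕ) : ℂ) * d (n + 1)) u) u := by
  obtain ⟨r, hur, hr1⟩ := exists_between hu
  have hr0 : 0 < r := (abs_nonneg u).trans_lt hur
  have hd' : PolyGrowth fun n => ((n + 1 : ℕ) : ℂ) * d (n + 1) := hd.natCast_mul.succ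
  have hsum : Summable fun n => ‖d n‖ * (n * r ^ (n - 1)) := by
    rw [← summable_nat_add_iff 1]
    refine (hd'.summable_norm (u := r) (by rwa [abs_of_pos hr0])).congr fun n => ?_
    simp only [norm_mul, norm_pow, Complex.norm_natCast, Complex.norm_real, Real.norm_eq_abs,
      abs_of_pos hr0, Nat.add_sub_cancel]
    ring
  have key := hasDerivAt_tsum_of_isPreconnected (𝕜 := ℝ) (F := ℂ) (y₀ := u) (y := u)
    (g := fun n (v : ℝ) => d n * (v : ℂ) ^ n)
    (g' := fun n (v : ℝ) => d n * (n * (v : ℂ) ^ (n - 1))) hsum (isOpen_Ioo (a := -r) (b := r))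
    isPreconnected_Ioo (fun n v _ => ?_) (fun n v hv => ?_) (abs_lt.1 hur)
    (hd.hasSum hu).summable (abs_lt.1 hur)
  · refine HasDerivAt.congr_deriv (f := powerSum d) key ?_
    rw [powerSum, Summable.tsum_eq_zero_add]
    · simp only [Nat.cast_zero, zero_mul, mul_zero, zero_add, Nat.add_sub_cancel]
      exact tsum_congr fun n => by ring
    · rw [← summable_nat_add_iff 1]
      refine (hd'.hasSum hu).summable.congr fun n => ?_
      simp only [Nat.add_sub_cancel]
      ring
  · have := ((hasDerivAt_pow n (v : ℂ)).const_mul (d n)).comp_ofReal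
    simpa using this
  · have hv' : |v| ≤ r := (abs_lt.2 hv).le
    simp only [norm_mul, norm_pow, Complex.norm_natCast, Complex.norm_real, Real.norm_eq_abs]
    gcongr

theorem hasDerivAt_powerSum_div (hd : PolyGrowth d) (hu : |u| < 1) (hu0 : u ≠ 0) :
    HasDerivAt (powerSum d) (powerSum (fun n => n * d n) u / u) u := by
  convert hasDerivAt_powerSum hd hu using 1
  have h0 : (u : ℂ) ≠ 0 := by exact_mod_cast hu0
  rw [powerSum_eq_add hd.natCast_mul hu]
  simp [mul_div_cancel_left₀ _ h0]

end powerSum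

/-- The difference is constant on (0, 1) and tends to 0 at 0. Derivatives are needed only on the
open interval because forms such as du/u are singular at 0. -/
theorem eqOn_of_hasDerivAt_eq {f g h : ℝ → ℂ} (hf : ∀ u ∈ Set.Ioo (0 : ℝ) 1, HasDerivAt f (h u) u)
    (hg : ∀ u ∈ Set.Ioo (0 : ℝ) 1, HasDerivAt g (h u) u) (hf0 : ContinuousAt f 0)
    (hg0 : ContinuousAt g 0) (h0 : f 0 = g 0) : ∀ u ∈ Set.Ioo (0 : ℝ) 1, f u = g u := by
  intro u hu
  have hd : ∀ v ∈ Set.Ioo (0 : ℝ) 1, HasDerivAt (fun v => f v - g v) 0 v := fun v hv => by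
    simpa using (hf v hv).fun_sub (hg v hv)
  have hconst : ∀ v ∈ Set.Ioo (0 : ℝ) 1, f v - g v = f u - g u := fun v hv =>
    isOpen_Ioo.is_const_of_deriv_eq_zero isPreconnected_Ioo
      (fun v hv => (hd v hv).differentiableAt.differentiableWithinAt) (fun v hv => (hd v hv).deriv)
      hv hu
  have hlim : Filter.Tendsto (fun v => f v - g v) (nhdsWithin 0 (Set.Ioi 0)) (nhds 0) := by
    have := (hf0.sub hg0).tendsto
    simp only [Pi.sub_apply, h0, sub_self] at this
    exact this.mono_left nhdsWithin_le_nhds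
  have hlim' : Filter.Tendsto (fun v => f v - g v) (nhdsWithin 0 (Set.Ioi 0))
      (nhds (f u - g u)) := by
    refine tendsto_const_nhds.congr' ?_
    filter_upwards [Ioo_mem_nhdsGT (zero_lt_one' ℝ)] with v hv
    exact (hconst v hv).symm
  exact sub_eq_zero.1 (tendsto_nhds_unique hlim' hlim)

/-! ### Polylogarithm coefficients and convergence at 1 -/

/-- The power series coefficients of `u ↦ Li_{s₁, …, s_d}(z₁ u, z₂, …, z_d)`. -/
noncomputable def liCoeff : List (ℕ × ℂ) → ℕ → ℂ
  | [] => Pi.single 0 1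
  | p :: L => fun n => p.2 ^ n / (n : ℂ) ^ p.1 * liPartial L n

/-- All exponents are positive and all arguments are fourth roots of unity. -/
def IsLevelFour (L : List (ℕ × ℂ)) : Prop := ∀ p ∈ L, 0 < p.1 ∧ p.2 ^ 4 = 1

theorem liPartial_nil (N : ℕ) : liPartial [] N = 1 := rfl

theorem liPartial_cons (p : ℕ × ℂ) (L : List (ℕ × ℂ)) (N : ℕ) :
    liPartial (p :: L) N = ∑ n ∈ Finset.Ico 1 N, liCoeff (p :: L) n := rfl

theorem liCoeff_cons_zero {p : ℕ × ℂ} (hp : 0 < p.1) (L : List (ℕ × ℂ)) :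
    liCoeff (p :: L) 0 = 0 := by
  simp [liCoeff, hp.ne']

theorem liPartial_cons_eq_sum_range {p : ℕ × ℂ} (hp : 0 < p.1) (L : List (ℕ × ℂ)) (N : ℕ) :
    liPartial (p :: L) N = ∑ n ∈ Finset.range N, liCoeff (p :: L) n := by
  rw [liPartial_cons]
  rcases N with _ | N
  · simp
  · rw [Finset.range_eq_Ico, Finset.sum_eq_sum_Ico_succ_bot (Nat.succ_pos N),
      liCoeff_cons_zero hp, zero_add]

theorem sum_one_div_sqrt_le (n : ℕ) :
    ∑ m ∈ Finset.range n, 1 / √((m : ℝ) + 1) ≤ 2 * √n := by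
  induction n with
  | zero => simp
  | succ n ih =>
    rw [Finset.sum_range_succ]
    have h0 : (0 : ℝ) ≤ n := n.cast_nonneg
    have hp : 0 < √((n : ℝ) + 1) := Real.sqrt_pos.2 (by positivity)
    have h1 : √((n : ℝ) + 1) ^ 2 = n + 1 := Real.sq_sqrt (by positivity)
    have h2 : √(n : ℝ) ^ 2 = n := Real.sq_sqrt h0
    have h3 : 1 / √((n : ℝ) + 1) ≤ 2 * √((n : ℝ) + 1) - 2 * √n := by
      rw [div_le_iff₀ hp]
      nlinarith [sq_nonneg (√((n : ℝ) + 1) - √n)]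
    push_cast
    linarith

theorem norm_term_le {p : ℕ × ℂ} (hp : 0 < p.1 ∧ p.2 ^ 4 = 1) (n : ℕ) :
    ‖p.2 ^ n / (n : ℂ) ^ p.1‖ ≤ 1 / n := by
  have hz : ‖p.2‖ = 1 := Complex.norm_eq_one_of_pow_eq_one hp.2 (by norm_num)
  rw [norm_div, norm_pow, norm_pow, hz, one_pow, Complex.norm_natCast]
  rcases n.eq_zero_or_pos with rfl | hn
  · simp [hp.1.ne']
  · have h1 : (1 : ℝ) ≤ n := by exact_mod_cast hn
    have : (n : ℝ) ≤ n ^ p.1 := le_self_pow₀ h1 hp.1.ne'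
    gcongr

/-- The square root replaces the true logarithmic growth: it is stable under the induction, as ∑
(1/m)√m = ∑ 1/√m ≤ 2√n, and still small enough for √n/n² to be summable. -/
theorem norm_liPartial_le {L : List (ℕ × ℂ)} (hL : IsLevelFour L) (n : ℕ) :
    ‖liPartial L (n + 1)‖ ≤ 2 ^ L.length * √((n : ℝ) + 1) := by
  induction L generalizing n with
  | nil => simp [liPartial_nil]
  | cons p L ih =>
    have hp := hL p (by simp)
    have hL' : IsLevelFour L := fun q hq => hL q (by simp [hq])
    rw [liPartial_cons_eq_sum_range hp.1, Finset.sum_range_succ', liCoeff_cons_zero hp.1, add_zero]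
    calc _ ≤ ∑ m ∈ Finset.range n, 2 ^ L.length * (1 / √((m : ℝ) + 1)) := by
          refine norm_sum_le_of_le _ fun m _ => ?_
          have h1 : (0 : ℝ) < (m : ℝ) + 1 := by positivity
          have hs : 0 < √((m : ℝ) + 1) := Real.sqrt_pos.2 h1
          have h2 := norm_term_le hp (m + 1)
          push_cast at h2
          simp only [liCoeff, norm_mul]
          push_cast
          calc _ ≤ 1 / ((m : ℝ) + 1) * (2 ^ L.length * √((m : ℝ) + 1)) := by
                gcongr
                exact ih hL' m
            _ = _ := by
                have := Real.mul_self_sqrt h1.le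
                field_simp
                nlinarith
      _ ≤ 2 ^ L.length * (2 * √n) := by
          rw [← Finset.mul_sum]
          gcongr
          exact sum_one_div_sqrt_le n
      _ ≤ 2 ^ L.length * (2 * √((n : ℝ) + 1)) := by
          gcongr
          linarith
      _ = _ := by rw [List.length_cons]; ring

theorem polyGrowth_liCoeff {L : List (ℕ × ℂ)} (hL : IsLevelFour L) : PolyGrowth (liCoeff L) := by
  rcases L with _ | ⟨p, L⟩
  · refine (PolyGrowth.const 1).of_norm_le fun n => ?_
    rcases n with _ | n <;> simp [liCoeff]
  · have hp := hL p (by simp)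
    have hL' : IsLevelFour L := fun q hq => hL q (by simp [hq])
    refine PolyGrowth.of_succ ⟨2 ^ L.length, 1, by positivity, fun n => ?_⟩
    have h2 := norm_term_le hp (n + 1)
    have h3 := norm_liPartial_le hL' n
    have h1 : (1 : ℝ) ≤ (n : ℝ) + 1 := by linarith [n.cast_nonneg (α := ℝ)]
    have h4 : √((n : ℝ) + 1) ≤ n + 1 := Real.sqrt_le_iff.2 ⟨by linarith, by nlinarith⟩
    have h5 : (1 : ℝ) / ((n + 1 : ℕ) : ℝ) ≤ 1 := by
      push_cast
      exact (div_le_one (by linarith)).2 h1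
    simp only [liCoeff, norm_mul, pow_one]
    calc _ ≤ 1 * (2 ^ L.length * √((n : ℝ) + 1)) := by
          gcongr
          exact h2.trans h5
      _ ≤ _ := by rw [one_mul]; gcongr

/-- Summation by parts: multiplying by 1 - z turns the partial sum into boundary terms plus an
absolutely convergent sum of differences of b. -/
theorem exists_tendsto_sum_pow_mul {z : ℂ} (hz1 : z ≠ 1) (hz : ‖z‖ = 1) {b : ℕ → ℂ}
    (hb : Filter.Tendsto b Filter.atTop (nhds 0)) (hsum : Summable fun n => ‖b (n + 1) - b n‖) :
    ∃ x, Filter.Tendsto (fun N => ∑ n ∈ Finset.range N, z ^ n * b n) Filter.atTop (nhds x) := by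
  have hz' : 1 - z ≠ 0 := sub_ne_zero.2 hz1.symm
  have key : ∀ N, ∑ n ∈ Finset.range N, z ^ n * b n = (b 0 - z ^ N * b N +
      ∑ n ∈ Finset.range N, z ^ (n + 1) * (b (n + 1) - b n)) / (1 - z) := fun N => by
    rw [eq_div_iff hz']
    induction N with
    | zero => simp
    | succ N ih =>
      rw [Finset.sum_range_succ, Finset.sum_range_succ, add_mul, ih]
      ring
  have h1 : Filter.Tendsto (fun N => z ^ N * b N) Filter.atTop (nhds 0) := by
    rw [tendsto_zero_iff_norm_tendsto_zero] at hb ⊢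
    simpa [hz] using hb
  have h2 : Summable fun n => z ^ (n + 1) * (b (n + 1) - b n) :=
    Summable.of_norm (hsum.congr fun n => by simp [hz])
  refine ⟨_, Filter.Tendsto.congr (fun N => (key N).symm)
    (((tendsto_const_nhds.sub h1).add h2.hasSum.tendsto_sum_nat).div_const _)⟩

theorem summable_sqrt_div_sq : Summable fun n : ℕ => √((n : ℝ) + 1) / ((n : ℝ) + 1) ^ 2 := by
  have h := (summable_nat_add_iff 1).2 (Real.summable_nat_rpow_inv.2
    (show (1 : ℝ) < 3 / 2 by norm_num))
  refine h.congr fun n => ?_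
  have h1 : (0 : ℝ) < (n : ℝ) + 1 := by positivity
  push_cast
  rw [Real.sqrt_eq_rpow, ← Real.rpow_natCast, ← Real.rpow_sub h1, ← Real.rpow_neg h1.le]
  norm_num

theorem tendsto_sqrt_div : Filter.Tendsto (fun n : ℕ => √((n : ℝ) + 1) / ((n : ℝ) + 1))
    Filter.atTop (nhds 0) := by
  have h := (tendsto_inv_atTop_zero (𝕜 := ℝ)).comp (Real.tendsto_sqrt_atTop.comp
    (Filter.tendsto_atTop_add_const_right Filter.atTop 1 (tendsto_natCast_atTop_atTop (R := ℝ))))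
  refine h.congr fun n => ?_
  simp only [Function.comp_apply]
  rw [Real.sqrt_div_self', one_div]

/-- For leading exponent at least 2 the outer series converges absolutely; for exponent 1 the
leading argument is not 1 and summation by parts applies. The second limit, which includes the index
0, is the one that Abel's theorem needs. -/
theorem exists_tendsto_sum_liCoeff {L : List (ℕ × ℂ)} (hL : IsLevelFour L)
    (hL1 : L.head? ≠ some (1, 1)) : ∃ x, Filter.Tendsto (liPartial L) Filter.atTop (nhds x) ∧
      Filter.Tendsto (fun N => ∑ n ∈ Finset.range N, liCoeff L n) Filter.atTop (nhds x) := by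
  rcases L with _ | ⟨⟨s, z⟩, L⟩
  · refine ⟨1, tendsto_const_nhds, tendsto_const_nhds.congr' ?_⟩
    filter_upwards [Filter.eventually_ge_atTop 1] with N hN
    rw [liCoeff, Finset.sum_pi_single', if_pos (Finset.mem_range.2 hN)]
  have hp := hL (s, z) (by simp)
  have hL' : IsLevelFour L := fun q hq => hL q (by simp [hq])
  simp only [funext (liPartial_cons_eq_sum_range hp.1 L), and_self]
  have hz : ‖z‖ = 1 := Complex.norm_eq_one_of_pow_eq_one hp.2 (by norm_num)
  have hb1 : ∀ n : ℕ, ‖liPartial L (n + 1) / ((n + 1 : ℕ) : ℂ) ^ s‖ ≤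
      2 ^ L.length * (√((n : ℝ) + 1) / ((n : ℝ) + 1) ^ s) := fun n => by
    rw [norm_div, norm_pow, Complex.norm_natCast, ← mul_div_assoc]
    push_cast
    gcongr
    exact norm_liPartial_le hL' n
  rcases (show 2 ≤ s ∨ s = 1 by have := hp.1; simp only at this; omega) with hs | rfl
  · refine ⟨_, (Summable.of_norm ?_).hasSum.tendsto_sum_nat⟩
    rw [← summable_nat_add_iff 1]
    refine Summable.of_nonneg_of_le (fun _ => norm_nonneg _) (fun n => ?_)
      (summable_sqrt_div_sq.mul_left (2 ^ L.length))
    have : liCoeff ((s, z) :: L) (n + 1) =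
        z ^ (n + 1) * (liPartial L (n + 1) / ((n + 1 : ℕ) : ℂ) ^ s) := by
      simp only [liCoeff]; ring
    rw [this, norm_mul, norm_pow, hz, one_pow, one_mul]
    refine (hb1 n).trans ?_
    have h1 : (1 : ℝ) ≤ (n : ℝ) + 1 := by linarith [n.cast_nonneg (α := ℝ)]
    gcongr
  · have hz1 : z ≠ 1 := by
      rintro rfl
      exact hL1 rfl
    have : ∀ n, liCoeff ((1, z) :: L) n = z ^ n * (liPartial L n / (n : ℂ) ^ 1) := fun n => by
      simp only [liCoeff]; ring
    simp only [this]
    refine exists_tendsto_sum_pow_mul hz1 hz ?_ ?_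
    · rw [← Filter.tendsto_add_atTop_iff_nat 1]
      refine squeeze_zero_norm hb1 ?_
      simpa using tendsto_sqrt_div.const_mul (2 ^ L.length)
    · rw [← summable_nat_add_iff 1]
      refine Summable.of_nonneg_of_le (fun _ => norm_nonneg _) (fun n => ?_)
        (summable_sqrt_div_sq.mul_left (2 * 2 ^ L.length))
      have h0 : (0 : ℝ) < (n : ℝ) + 1 := by positivity
      have hdiff : ‖liPartial L (n + 1 + 1) - liPartial L (n + 1)‖ ≤
          2 ^ L.length * (√((n : ℝ) + 1) / ((n : ℝ) + 1)) := by
        rcases L with _ | ⟨p, T⟩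
        · simp only [liPartial_nil, sub_self, norm_zero]
          positivity
        · have hp' := hL' p (by simp)
          rw [liPartial_cons_eq_sum_range hp'.1, liPartial_cons_eq_sum_range hp'.1,
            Finset.sum_range_succ _ (n + 1), add_sub_cancel_left]
          have h2 := norm_term_le hp' (n + 1)
          have h3 := norm_liPartial_le (L := T) (fun q hq => hL' q (by simp [hq])) n
          simp only [liCoeff, norm_mul]
          calc _ ≤ 1 / ((n + 1 : ℕ) : ℝ) * (2 ^ T.length * √((n : ℝ) + 1)) := by gcongr
            _ = 2 ^ T.length * (√((n : ℝ) + 1) / ((n : ℝ) + 1)) := by push_cast; ring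
            _ ≤ _ := by
              gcongr
              · norm_num
              · simp
      have hT := norm_liPartial_le hL' n
      -- Discrete product rule: the increment of `liPartial` and the increment of 1/n each
      -- contribute a term of size √n/n².
      have e1 : liPartial L (n + 1 + 1) / ((n + 1 + 1 : ℕ) : ℂ) ^ 1 -
          liPartial L (n + 1) / ((n + 1 : ℕ) : ℂ) ^ 1 =
          (liPartial L (n + 1 + 1) - liPartial L (n + 1)) / ((n + 1 + 1 : ℕ) : ℂ) -
          liPartial L (n + 1) / (((n + 1 : ℕ) : ℂ) * ((n + 1 + 1 : ℕ) : ℂ)) := by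
        have h1 : ((n + 1 : ℕ) : ℂ) ≠ 0 := Nat.cast_ne_zero.2 (by omega)
        have h2 : ((n + 1 + 1 : ℕ) : ℂ) ≠ 0 := Nat.cast_ne_zero.2 (by omega)
        field_simp
        push_cast
        ring
      rw [e1]
      refine (norm_sub_le _ _).trans ?_
      rw [norm_div, norm_div, norm_mul, Complex.norm_natCast, Complex.norm_natCast]
      have h12 : (n : ℝ) + 1 ≤ ((n + 1 + 1 : ℕ) : ℝ) := by push_cast; linarith
      calc _ ≤ 2 ^ L.length * (√((n : ℝ) + 1) / ((n : ℝ) + 1)) / ((n : ℝ) + 1) +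
            2 ^ L.length * √((n : ℝ) + 1) / (((n : ℝ) + 1) * ((n : ℝ) + 1)) := by
            gcongr
            push_cast
            exact le_rfl
        _ = _ := by field_simp; ring

/-! ### Spans of polylogarithms and integration operators -/

/-- The `ℚ`-span of the coefficient sequences of level four polylogarithms of weight `w`. -/
noncomputable def liSpan (w : ℕ) : Submodule ℚ (ℕ → ℂ) :=
  Submodule.span ℚ {d | ∃ L, IsLevelFour L ∧ (L.map Prod.fst).sum = w ∧ liCoeff L = d}

/-- The part of `liSpan w` spanned by the polylogarithms that converge at `1`. -/
noncomputable def convLiSpan (w : ℕ) : Submodule ℚ (ℕ → ℂ) :=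
  Submodule.span ℚ {d | ∃ L, IsLevelFour L ∧ L.head? ≠ some (1, 1) ∧
    (L.map Prod.fst).sum = w ∧ liCoeff L = d}

/-- Integration against `du / u` on coefficient sequences, ignoring the constant term. -/
noncomputable def intZero : (ℕ → ℂ) →ₗ[ℚ] (ℕ → ℂ) where
  toFun d n := d n / n
  map_add' d e := by ext n; simp [add_div]
  map_smul' a d := by ext n; simp [smul_div_assoc]

/-- Integration against `z du / (1 - z u)` on coefficient sequences. -/
noncomputable def intPole (z : ℂ) : (ℕ → ℂ) →ₗ[ℚ] (ℕ → ℂ) where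
  toFun d n := z ^ n / n * ∑ m ∈ Finset.range n, z⁻¹ ^ m * d m
  map_add' d e := by ext n; simp [mul_add, Finset.sum_add_distrib]
  map_smul' a d := by ext n; simp [← Finset.smul_sum]

/-- The constant term of a power series. -/
noncomputable def constTerm : (ℕ → ℂ) →ₗ[ℚ] (ℕ → ℂ) where
  toFun d := Pi.single 0 (d 0)
  map_add' d e := by simp [Pi.single_add]
  map_smul' a d := by simp [Pi.single_smul]

theorem convLiSpan_le (w : ℕ) : convLiSpan w ≤ liSpan w :=
  Submodule.span_mono fun _ ⟨L, h, _, h'⟩ => ⟨L, h, h'⟩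

theorem polyGrowth_of_mem_liSpan {w : ℕ} {d : ℕ → ℂ} (hd : d ∈ liSpan w) : PolyGrowth d := by
  induction hd using Submodule.span_induction with
  | mem d h =>
    obtain ⟨L, hL, -, rfl⟩ := h
    exact polyGrowth_liCoeff hL
  | zero => exact PolyGrowth.const 0
  | add d e _ _ hd he => exact hd.add he
  | smul a d _ hd =>
    refine (hd.const_mul (a : ℂ)).of_norm_le fun n => ?_
    rw [Pi.smul_apply, Rat.smul_def]

theorem map_mem_of_liSpan {w : ℕ} {d : ℕ → ℂ} (hd : d ∈ liSpan w) (f : (ℕ → ℂ) →ₗ[ℚ] (ℕ → ℂ))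
    (S : Submodule ℚ (ℕ → ℂ))
    (h : ∀ L, IsLevelFour L → (L.map Prod.fst).sum = w → f (liCoeff L) ∈ S) : f d ∈ S := by
  have : liSpan w ≤ S.comap f := Submodule.span_le.2 fun _ ⟨L, h1, h2, h3⟩ => h3 ▸ h L h1 h2
  exact this hd

theorem isLevelFour_cons {p : ℕ × ℂ} {L : List (ℕ × ℂ)} :
    IsLevelFour (p :: L) ↔ (0 < p.1 ∧ p.2 ^ 4 = 1) ∧ IsLevelFour L := by
  simp [IsLevelFour]

/-- The leading exponent rises to at least 2, so the new word converges at 1. The empty word is sent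
to 0, its only coefficient being divided by 0. -/
theorem intZero_mem {w : ℕ} {d : ℕ → ℂ} (hd : d ∈ liSpan w) : intZero d ∈ convLiSpan (w + 1) := by
  refine map_mem_of_liSpan hd _ _ fun L hL hs => ?_
  rcases L with _ | ⟨⟨s, z⟩, L⟩
  · convert Submodule.zero_mem _
    ext n
    rcases n with _ | n <;> simp [intZero, liCoeff]
  · rw [isLevelFour_cons] at hL
    refine Submodule.subset_span ⟨(s + 1, z) :: L, isLevelFour_cons.2 ⟨⟨by simp, hL.1.2⟩, hL.2⟩,
      ?_, ?_, ?_⟩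
    · have := hL.1.1
      simp only at this
      simp
      omega
    · simp at hs ⊢
      omega
    · ext n
      simp only [intZero, liCoeff, LinearMap.coe_mk, AddHom.coe_mk, pow_succ, div_eq_mul_inv,
        mul_inv]
      ring

/-- The factor z⁻ᵐ in the inner sum is absorbed by the next argument, which becomes z'/z; fourth
roots of unity are closed under this. -/
theorem intPole_liCoeff (z : ℂ) {L : List (ℕ × ℂ)} (hL : IsLevelFour L) :
    intPole z (liCoeff L) = liCoeff (match L with
      | [] => [(1, z)]
      | p :: L => (1, z) :: (p.1, p.2 / z) :: L) := by
  rcases L with _ | ⟨⟨s, z'⟩, L⟩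
  · ext n
    rcases n with _ | n
    · simp [intPole, liCoeff]
    · simp [intPole, liCoeff, liPartial_nil, Pi.single_apply, Finset.sum_ite_eq']
  · rw [isLevelFour_cons] at hL
    ext n
    change _ = z ^ n / (n : ℂ) ^ 1 * liPartial ((s, z' / z) :: L) n
    simp only [intPole, LinearMap.coe_mk, AddHom.coe_mk]
    rw [liPartial_cons_eq_sum_range (p := (s, z' / z)) hL.1.1]
    simp only [liCoeff, pow_one]
    congr 1
    refine Finset.sum_congr rfl fun m _ => ?_
    simp only [inv_pow, div_eq_mul_inv]
    ring

theorem intPole_mem {w : ℕ} {d : ℕ → ℂ} (hd : d ∈ liSpan w) {z : ℂ} (hz : z ^ 4 = 1) :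
    intPole z d ∈ liSpan (w + 1) := by
  refine map_mem_of_liSpan hd _ _ fun L hL hs => ?_
  rw [intPole_liCoeff z hL]
  rcases L with _ | ⟨⟨s, z'⟩, L⟩ <;> refine Submodule.subset_span ⟨_, ?_, ?_, rfl⟩
  · simpa [IsLevelFour] using hz
  · simp at hs ⊢
    omega
  · simp only [isLevelFour_cons] at hL ⊢
    exact ⟨⟨one_pos, hz⟩, ⟨hL.1.1, by rw [div_pow, hz, hL.1.2, div_one]⟩, hL.2⟩
  · simp at hs ⊢
    omega

theorem intPole_mem_conv {w : ℕ} {d : ℕ → ℂ} (hd : d ∈ liSpan w) {z : ℂ} (hz : z ^ 4 = 1)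
    (hz1 : z ≠ 1) : intPole z d ∈ convLiSpan (w + 1) := by
  refine map_mem_of_liSpan hd _ _ fun L hL hs => ?_
  rw [intPole_liCoeff z hL]
  rcases L with _ | ⟨⟨s, z'⟩, L⟩ <;> refine Submodule.subset_span ⟨_, ?_, ?_, ?_, rfl⟩
  · simpa [IsLevelFour] using hz
  · simpa using hz1
  · simp at hs ⊢
    omega
  · simp only [isLevelFour_cons] at hL ⊢
    exact ⟨⟨one_pos, hz⟩, ⟨hL.1.1, by rw [div_pow, hz, hL.1.2, div_one]⟩, hL.2⟩
  · simpa using hz1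
  · simp at hs ⊢
    omega

/-- Only the empty word has a nonzero constant term, so the constant part is homogeneous and
vanishes in positive weight. -/
theorem constTerm_mem {w : ℕ} {d : ℕ → ℂ} (hd : d ∈ liSpan w) : constTerm d ∈ liSpan w := by
  refine map_mem_of_liSpan hd _ _ fun L hL hs => ?_
  rcases L with _ | ⟨p, L⟩
  · exact Submodule.subset_span ⟨[], hL, hs, by simp [constTerm, liCoeff]⟩
  · convert Submodule.zero_mem _
    rw [isLevelFour_cons] at hL
    simp [constTerm, liCoeff_cons_zero hL.1.1]

theorem one_mem_liSpan : (Pi.single 0 1 : ℕ → ℂ) ∈ liSpan 0 :=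
  Submodule.subset_span ⟨[], by simp [IsLevelFour], rfl, rfl⟩

theorem tendsto_powerSum_of_mem {w : ℕ} {d : ℕ → ℂ} (hd : d ∈ convLiSpan w) :
    ∃ c ∈ CMZV 4 w, Filter.Tendsto (powerSum d) (nhdsWithin 1 (Set.Iio 1)) (nhds c) := by
  have hev : ∀ᶠ u : ℝ in nhdsWithin 1 (Set.Iio 1), |u| < 1 := by
    filter_upwards [Ioo_mem_nhdsLT (zero_lt_one' ℝ)] with u hu
    rw [abs_of_pos hu.1]
    exact hu.2
  induction hd using Submodule.span_induction with
  | mem d h =>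
    obtain ⟨L, hL, h1, hs, rfl⟩ := h
    obtain ⟨x, hx, hx'⟩ := exists_tendsto_sum_liCoeff hL h1
    refine ⟨x, Submodule.subset_span ⟨L, hL, h1, hs, hx⟩, ?_⟩
    exact Filter.tendsto_map'_iff.1 (Complex.tendsto_tsum_powerSeries_nhdsWithin_lt hx')
  | zero =>
    refine ⟨0, Submodule.zero_mem _, tendsto_const_nhds.congr fun u => ?_⟩
    simp [powerSum]
  | add d e hd he ihd ihe =>
    obtain ⟨c, hc, h⟩ := ihd
    obtain ⟨c', hc', h'⟩ := ihe
    refine ⟨c + c', Submodule.add_mem _ hc hc', (h.add h').congr' ?_⟩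
    filter_upwards [hev] with u hu
    exact (powerSum_add (polyGrowth_of_mem_liSpan (convLiSpan_le w hd))
      (polyGrowth_of_mem_liSpan (convLiSpan_le w he)) hu).symm
  | smul a d hd ih =>
    obtain ⟨c, hc, h⟩ := ih
    refine ⟨a • c, Submodule.smul_mem _ _ hc, ?_⟩
    rw [Rat.smul_def]
    refine (h.const_mul (a : ℂ)).congr fun u => ?_
    rw [← powerSum_const_mul]
    congr 1

/-! ### Derivatives of the integrated series -/

section derivatives

variable {d : ℕ → ℂ} {u : ℝ}

theorem PolyGrowth.intZero (hd : PolyGrowth d) : PolyGrowth (intZero d) := by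
  simpa [_root_.intZero] using hd.div_natCast_pow 1

theorem PolyGrowth.sum_inv_pow (hd : PolyGrowth d) {z : ℂ} (hz : ‖z‖ = 1) :
    PolyGrowth fun n => z ^ n * ∑ m ∈ Finset.range n, z⁻¹ ^ m * d m := by
  refine PolyGrowth.of_norm_le (PolyGrowth.sum_range (d := fun m => z⁻¹ ^ m * d m)
    (hd.of_norm_le fun n => ?_)) fun n => ?_ <;> simp [hz]

theorem PolyGrowth.intPole (hd : PolyGrowth d) {z : ℂ} (hz : ‖z‖ = 1) :
    PolyGrowth (intPole z d) := by
  convert (hd.sum_inv_pow hz).div_natCast_pow 1 using 2 with n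
  simp only [_root_.intPole, LinearMap.coe_mk, AddHom.coe_mk, pow_one]
  ring

theorem powerSum_single (a : ℂ) (u : ℝ) : powerSum (Pi.single 0 a) u = a := by
  rw [powerSum, tsum_eq_single 0]
  · simp
  · intro n hn
    simp [hn]

theorem polyGrowth_single (a : ℂ) : PolyGrowth (Pi.single 0 a) := by
  refine (PolyGrowth.const a).of_norm_le fun n => ?_
  rcases n with _ | n <;> simp

theorem hasDerivAt_intZero (hd : PolyGrowth d) (hu : |u| < 1) (hu0 : u ≠ 0) :
    HasDerivAt (powerSum (intZero d)) ((powerSum d u - d 0) / u) u := by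
  convert hasDerivAt_powerSum_div hd.intZero hu hu0 using 2
  rw [← powerSum_single (d 0) u, ← powerSum_sub hd (polyGrowth_single _) hu]
  congr 1
  ext n
  rcases n with _ | n
  · simp
  · have : ((n + 1 : ℕ) : ℂ) ≠ 0 := Nat.cast_ne_zero.2 (by omega)
    simp only [intZero, LinearMap.coe_mk, AddHom.coe_mk, mul_div_cancel₀ _ this]
    simp

theorem one_sub_mul_ne_zero {z : ℂ} (hz : ‖z‖ = 1) (hu : |u| < 1) : 1 - z * u ≠ 0 := by
  intro h
  have : ‖z * u‖ = 1 := by rw [← sub_eq_zero.1 h, norm_one]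
  rw [norm_mul, hz, one_mul, Complex.norm_real, Real.norm_eq_abs] at this
  exact hu.ne this

/-- The coefficients e of u times the derivative satisfy e_{n+1} = z(e_n + d_n), which says that
their series E and the series D of d satisfy (1 - zu)E = zuD. -/
theorem hasDerivAt_intPole (hd : PolyGrowth d) {z : ℂ} (hz : ‖z‖ = 1) (hu : |u| < 1)
    (hu0 : u ≠ 0) : HasDerivAt (powerSum (intPole z d)) (z * powerSum d u / (1 - z * u)) u := by
  convert hasDerivAt_powerSum_div (hd.intPole hz) hu hu0 using 1
  have hz0 : z ≠ 0 := by rintro rfl; simp at hz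
  have hu0' : (u : ℂ) ≠ 0 := by exact_mod_cast hu0
  have hE := hd.sum_inv_pow hz
  set e : ℕ → ℂ := fun n => z ^ n * ∑ m ∈ Finset.range n, z⁻¹ ^ m * d m with he
  have h1 : (fun n : ℕ => (n : ℂ) * intPole z d n) = e := by
    ext n
    rcases n with _ | n
    · simp [he]
    · have : ((n + 1 : ℕ) : ℂ) ≠ 0 := Nat.cast_ne_zero.2 (by omega)
      simp only [intPole, LinearMap.coe_mk, AddHom.coe_mk, he]
      field_simp
  have h2 : (fun n => e (n + 1)) = fun n => z * e n + z * d n := by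
    ext n
    simp only [he, Finset.sum_range_succ, inv_pow]
    field_simp
    ring
  have h3 := powerSum_eq_add hE hu
  rw [h2, powerSum_add (hE.const_mul z) (hd.const_mul z) hu, powerSum_const_mul,
    powerSum_const_mul] at h3
  have h4 : e 0 = 0 := by simp [he]
  rw [h4, zero_add] at h3
  rw [h1, div_eq_div_iff (one_sub_mul_ne_zero hz hu) hu0']
  linear_combination (-1 : ℂ) * h3

end derivatives

theorem hasDerivAt_powerSum_add {d e : ℕ → ℂ} {u : ℝ} {d' e' : ℂ} (hd : PolyGrowth d)
    (he : PolyGrowth e) (hu : |u| < 1) (h : HasDerivAt (powerSum d) d' u)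
    (h' : HasDerivAt (powerSum e) e' u) : HasDerivAt (powerSum (d + e)) (d' + e') u := by
  refine (h.add h').congr_of_eventuallyEq ?_
  filter_upwards [(continuous_abs.tendsto u).eventually_lt_const hu] with v hv
  exact powerSum_add hd he hv

theorem hasDerivAt_powerSum_const_mul {d : ℕ → ℂ} {u : ℝ} {d' : ℂ} (a : ℂ)
    (h : HasDerivAt (powerSum d) d' u) :
    HasDerivAt (powerSum (fun n => a * d n)) (a * d') u :=
  (h.const_mul a).congr_of_eventuallyEq (Filter.Eventually.of_forall (powerSum_const_mul a d))

theorem hasDerivAt_powerSum_sub {d e : ℕ → ℂ} {u : ℝ} {d' e' : ℂ} (hd : PolyGrowth d)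
    (he : PolyGrowth e) (hu : |u| < 1) (h : HasDerivAt (powerSum d) d' u)
    (h' : HasDerivAt (powerSum e) e' u) : HasDerivAt (powerSum (d - e)) (d' - e') u := by
  refine (h.sub h').congr_of_eventuallyEq ?_
  filter_upwards [(continuous_abs.tendsto u).eventually_lt_const hu] with v hv
  exact powerSum_sub hd he hv

theorem abs_lt_one_of_mem_Ioo {u : ℝ} (hu : u ∈ Set.Ioo (0 : ℝ) 1) : |u| < 1 := by
  rw [abs_of_pos hu.1]
  exact hu.2

theorem continuousAt_powerSum {d : ℕ → ℂ} (hd : PolyGrowth d) {u : ℝ} (hu : |u| < 1) :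
    ContinuousAt (powerSum d) u :=
  (hasDerivAt_powerSum hd hu).continuousAt

theorem eq_powerSum_of_hasDerivAt {f h : ℝ → ℂ} {e : ℕ → ℂ} (he : PolyGrowth e)
    (hf : ∀ u ∈ Set.Ioo (0 : ℝ) 1, HasDerivAt f (h u) u)
    (hg : ∀ u ∈ Set.Ioo (0 : ℝ) 1, HasDerivAt (powerSum e) (h u) u)
    (hf0 : ContinuousAt f 0) (h0 : f 0 = e 0) : ∀ u ∈ Set.Ioo (0 : ℝ) 1, f u = powerSum e u :=
  eqOn_of_hasDerivAt_eq hf hg hf0 (continuousAt_powerSum he (by simp)) (by rw [h0, powerSum_zero])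

/-! ### The differential forms in the half-angle variable -/

/-- Integration against `-2 u du / (1 + u²)`. -/
noncomputable def intImSum : (ℕ → ℂ) →ₗ[ℚ] (ℕ → ℂ) := intPole Complex.I + intPole (-Complex.I)

/-- Integration against `2 i du / (1 + u²)`. -/
noncomputable def intImDiff : (ℕ → ℂ) →ₗ[ℚ] (ℕ → ℂ) := intPole Complex.I - intPole (-Complex.I)

/-- Integration against `2 u du / (1 - u²)`. -/
noncomputable def intReSum : (ℕ → ℂ) →ₗ[ℚ] (ℕ → ℂ) := intPole 1 + intPole (-1)

/-- Integration against `dx / x`, where `x = 2 u / (1 + u²)`. -/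
noncomputable def intLog : (ℕ → ℂ) →ₗ[ℚ] (ℕ → ℂ) := intZero + intImSum

section

variable {d : ℕ → ℂ}

theorem intPole_apply_zero (z : ℂ) (d : ℕ → ℂ) : intPole z d 0 = 0 := by simp [intPole]

theorem intZero_apply_zero (d : ℕ → ℂ) : intZero d 0 = 0 := by simp [intZero]

theorem intImSum_apply_zero (d : ℕ → ℂ) : intImSum d 0 = 0 := by
  simp [intImSum, intPole_apply_zero]

theorem intImDiff_apply_zero (d : ℕ → ℂ) : intImDiff d 0 = 0 := by
  simp [intImDiff, intPole_apply_zero]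

theorem intReSum_apply_zero (d : ℕ → ℂ) : intReSum d 0 = 0 := by
  simp [intReSum, intPole_apply_zero]

theorem intLog_apply_zero (d : ℕ → ℂ) : intLog d 0 = 0 := by
  simp [intLog, intZero_apply_zero, intImSum_apply_zero]

theorem PolyGrowth.intImSum (hd : PolyGrowth d) : PolyGrowth (intImSum d) :=
  (hd.intPole (by simp)).add (hd.intPole (by simp))

theorem PolyGrowth.intImDiff (hd : PolyGrowth d) : PolyGrowth (intImDiff d) :=
  (hd.intPole (by simp)).sub (hd.intPole (by simp))

theorem PolyGrowth.intReSum (hd : PolyGrowth d) : PolyGrowth (intReSum d) :=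
  (hd.intPole (by simp)).add (hd.intPole (by simp))

theorem PolyGrowth.intLog (hd : PolyGrowth d) : PolyGrowth (intLog d) :=
  hd.intZero.add hd.intImSum

variable {w : ℕ}

theorem intImSum_mem (hd : d ∈ liSpan w) : intImSum d ∈ convLiSpan (w + 1) :=
  Submodule.add_mem _ (intPole_mem_conv hd Complex.I_pow_four (by simp [Complex.ext_iff]))
    (intPole_mem_conv hd (by rw [Even.neg_pow (by decide), Complex.I_pow_four])
      (by simp [Complex.ext_iff]))

theorem intImDiff_mem (hd : d ∈ liSpan w) : intImDiff d ∈ convLiSpan (w + 1) :=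
  Submodule.sub_mem _ (intPole_mem_conv hd Complex.I_pow_four (by simp [Complex.ext_iff]))
    (intPole_mem_conv hd (by rw [Even.neg_pow (by decide), Complex.I_pow_four])
      (by simp [Complex.ext_iff]))

theorem intReSum_mem (hd : d ∈ liSpan w) : intReSum d ∈ liSpan (w + 1) :=
  Submodule.add_mem _ (intPole_mem hd (one_pow 4)) (intPole_mem hd (by norm_num))

theorem intLog_mem (hd : d ∈ liSpan w) : intLog d ∈ convLiSpan (w + 1) :=
  Submodule.add_mem _ (intZero_mem hd) (intImSum_mem hd)

variable {u : ℝ}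

theorem one_add_sq_ne_zero (u : ℝ) : (1 + (u : ℂ) ^ 2) ≠ 0 := by
  have : (1 + u ^ 2 : ℝ) ≠ 0 := by positivity
  exact_mod_cast this

theorem one_sub_sq_ne_zero (hu : u ∈ Set.Ioo (0 : ℝ) 1) : (1 - (u : ℂ) ^ 2) ≠ 0 := by
  have : (1 - u ^ 2 : ℝ) ≠ 0 := by nlinarith [hu.1, hu.2]
  exact_mod_cast this

theorem hasDerivAt_intImSum (hd : PolyGrowth d) (hu : u ∈ Set.Ioo (0 : ℝ) 1) :
    HasDerivAt (powerSum (intImSum d)) (-(2 * u / (1 + u ^ 2)) * powerSum d u) u := by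
  have hu1 := abs_lt_one_of_mem_Ioo hu
  have hI : ‖Complex.I‖ = 1 := by simp
  have hI' : ‖-Complex.I‖ = 1 := by simp
  refine (hasDerivAt_powerSum_add (hd.intPole hI) (hd.intPole hI') hu1
    (hasDerivAt_intPole hd hI hu1 hu.1.ne')
    (hasDerivAt_intPole hd hI' hu1 hu.1.ne')).congr_deriv ?_
  have h1 := one_sub_mul_ne_zero hI hu1
  have h2 := one_sub_mul_ne_zero hI' hu1
  have hm : (1 - Complex.I * u) * (1 - -Complex.I * u) = 1 + (u : ℂ) ^ 2 := by
    linear_combination (-(u : ℂ) ^ 2) * Complex.I_sq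
  rw [div_add_div _ _ h1 h2, hm, ← neg_div, div_mul_eq_mul_div]
  congr 1
  linear_combination (2 * u * powerSum d u) * Complex.I_sq

theorem hasDerivAt_intImDiff (hd : PolyGrowth d) (hu : u ∈ Set.Ioo (0 : ℝ) 1) :
    HasDerivAt (powerSum (intImDiff d)) (Complex.I * (2 / (1 + u ^ 2) * powerSum d u)) u := by
  have hu1 := abs_lt_one_of_mem_Ioo hu
  have hI : ‖Complex.I‖ = 1 := by simp
  have hI' : ‖-Complex.I‖ = 1 := by simp
  refine (hasDerivAt_powerSum_sub (hd.intPole hI) (hd.intPole hI') hu1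
    (hasDerivAt_intPole hd hI hu1 hu.1.ne')
    (hasDerivAt_intPole hd hI' hu1 hu.1.ne')).congr_deriv ?_
  have h1 := one_sub_mul_ne_zero hI hu1
  have h2 := one_sub_mul_ne_zero hI' hu1
  have hm : (1 - Complex.I * u) * (1 - -Complex.I * u) = 1 + (u : ℂ) ^ 2 := by
    linear_combination (-(u : ℂ) ^ 2) * Complex.I_sq
  rw [div_sub_div _ _ h1 h2, hm, div_mul_eq_mul_div, ← mul_div_assoc]
  congr 1
  ring

theorem hasDerivAt_intReSum (hd : PolyGrowth d) (hu : u ∈ Set.Ioo (0 : ℝ) 1) :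
    HasDerivAt (powerSum (intReSum d)) (2 * u / (1 - u ^ 2) * powerSum d u) u := by
  have hu1 := abs_lt_one_of_mem_Ioo hu
  have hI : ‖(1 : ℂ)‖ = 1 := by simp
  have hI' : ‖-(1 : ℂ)‖ = 1 := by simp
  refine (hasDerivAt_powerSum_add (hd.intPole hI) (hd.intPole hI') hu1
    (hasDerivAt_intPole hd hI hu1 hu.1.ne')
    (hasDerivAt_intPole hd hI' hu1 hu.1.ne')).congr_deriv ?_
  have h1 := one_sub_mul_ne_zero hI hu1
  have h2 := one_sub_mul_ne_zero hI' hu1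
  have hm : (1 - (1 : ℂ) * u) * (1 - -1 * u) = 1 - (u : ℂ) ^ 2 := by ring
  rw [div_add_div _ _ h1 h2, hm, div_mul_eq_mul_div]
  congr 1
  ring

theorem hasDerivAt_intLog (hd : PolyGrowth d) (hd0 : d 0 = 0) (hu : u ∈ Set.Ioo (0 : ℝ) 1) :
    HasDerivAt (powerSum (intLog d)) ((1 - u ^ 2) / (1 + u ^ 2) / u * powerSum d u) u := by
  have hu1 := abs_lt_one_of_mem_Ioo hu
  refine (hasDerivAt_powerSum_add hd.intZero hd.intImSum hu1
    (hasDerivAt_intZero hd hu1 hu.1.ne') (hasDerivAt_intImSum hd hu)).congr_deriv ?_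
  have h3 := one_add_sq_ne_zero u
  have h4 : (u : ℂ) ≠ 0 := by exact_mod_cast hu.1.ne'
  rw [hd0]
  field_simp
  ring

end

/-! ### The half-angle substitution -/

/-- The rational parametrization `u ↦ 2 u / (1 + u²)` of `sin θ` by `u = tan (θ / 2)`. -/
noncomputable def sinParam (u : ℝ) : ℝ := 2 * u / (1 + u ^ 2)

theorem sinParam_mem {u : ℝ} (hu : u ∈ Set.Ioo (0 : ℝ) 1) : sinParam u ∈ Set.Ioo (0 : ℝ) 1 := by
  obtain ⟨h0, h1⟩ := hu
  refine ⟨by unfold sinParam; positivity, ?_⟩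
  rw [sinParam, div_lt_one (by positivity)]
  nlinarith [mul_pos (sub_pos.2 h1) (sub_pos.2 h1)]

theorem sinParam_sq_mem {u : ℝ} (hu : u ∈ Set.Ioo (0 : ℝ) 1) :
    sinParam u ^ 2 ∈ Set.Ioo (0 : ℝ) 1 :=
  ⟨pow_pos (sinParam_mem hu).1 2, pow_lt_one₀ (sinParam_mem hu).1.le (sinParam_mem hu).2 two_ne_zero⟩

theorem hasDerivAt_sinParam (u : ℝ) :
    HasDerivAt sinParam (2 * (1 - u ^ 2) / (1 + u ^ 2) ^ 2) u := by
  have h : (1 + u ^ 2 : ℝ) ≠ 0 := by positivity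
  refine (((hasDerivAt_id u).const_mul 2).div ((hasDerivAt_pow 2 u).const_add 1) h).congr_deriv
    ?_
  simp only [id]
  field_simp
  ring

theorem continuous_sinParam : Continuous sinParam :=
  continuous_iff_continuousAt.2 fun u => (hasDerivAt_sinParam u).continuousAt

section

variable {d : ℕ → ℂ} {u : ℝ}

theorem continuousAt_powerSum_sinParam (hd : PolyGrowth d) :
    ContinuousAt (fun u => powerSum d (sinParam u ^ 2)) 0 := by
  refine ContinuousAt.comp (g := powerSum d) (f := fun u => sinParam u ^ 2)
    (continuousAt_powerSum hd ?_) (continuous_sinParam.pow 2).continuousAt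
  simp [sinParam]

theorem powerSum_sinParam_zero (d : ℕ → ℂ) : powerSum d (sinParam 0 ^ 2) = d 0 := by
  simp [sinParam, powerSum_zero]

theorem hasDerivAt_powerSum_sinParam (hd : PolyGrowth d) (hu : u ∈ Set.Ioo (0 : ℝ) 1) :
    HasDerivAt (fun u => powerSum d (sinParam u ^ 2))
      (2 * ((1 - u ^ 2) / (1 + u ^ 2) / u) * powerSum (fun n => n * d n) (sinParam u ^ 2)) u := by
  have hX := sinParam_sq_mem hu
  refine ((hasDerivAt_powerSum_div hd (abs_lt_one_of_mem_Ioo hX) hX.1.ne').scomp u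
    ((hasDerivAt_sinParam u).pow 2)).congr_deriv ?_
  have h3 := one_add_sq_ne_zero u
  have h4 : (u : ℂ) ≠ 0 := by exact_mod_cast hu.1.ne'
  rw [Complex.real_smul]
  simp only [sinParam]
  push_cast
  field_simp

theorem hasDerivAt_sinParam_mul_powerSum (hd : PolyGrowth d) (hu : u ∈ Set.Ioo (0 : ℝ) 1) :
    HasDerivAt (fun u => (sinParam u : ℂ) * powerSum d (sinParam u ^ 2))
      ((1 - u ^ 2) / (1 + u ^ 2) / u *
        (sinParam u * powerSum (fun n => (2 * n + 1) * d n) (sinParam u ^ 2))) u := by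
  have hX := abs_lt_one_of_mem_Ioo (sinParam_sq_mem hu)
  refine ((hasDerivAt_sinParam u).ofReal_comp.mul (hasDerivAt_powerSum_sinParam hd hu)).congr_deriv
    ?_
  have h3 := one_add_sq_ne_zero u
  have h4 : (u : ℂ) ≠ 0 := by exact_mod_cast hu.1.ne'
  have : powerSum (fun n => (2 * n + 1) * d n) (sinParam u ^ 2) =
      2 * powerSum (fun n => n * d n) (sinParam u ^ 2) + powerSum d (sinParam u ^ 2) := by
    rw [← powerSum_const_mul, ← powerSum_add (hd.natCast_mul.const_mul 2) hd hX]
    congr 1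
    ext n
    ring
  rw [this]
  simp only [sinParam]
  push_cast
  field_simp
  ring

end

/-! ### Central binomial generating functions -/

theorem aCoeff_zero : aCoeff 0 = 1 := by simp [aCoeff]

theorem aCoeff_nonneg (n : ℕ) : 0 ≤ aCoeff n := by unfold aCoeff; positivity

theorem aCoeff_succ (n : ℕ) : 2 * ((n : ℝ) + 1) * aCoeff (n + 1) = (2 * n + 1) * aCoeff n := by
  have h : ((n : ℝ) + 1) * (n + 1).centralBinom = 2 * (2 * n + 1) * n.centralBinom := by
    exact_mod_cast Nat.succ_mul_centralBinom_succ n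
  have h4 : (4 : ℝ) ^ n ≠ 0 := by positivity
  rw [aCoeff, aCoeff, pow_succ]
  field_simp
  linear_combination 2 * h

theorem aCoeff_le_one (n : ℕ) : aCoeff n ≤ 1 := by
  induction n with
  | zero => rw [aCoeff_zero]
  | succ n ih =>
    have h0 : (0 : ℝ) ≤ n := n.cast_nonneg
    nlinarith [aCoeff_succ n, aCoeff_nonneg n, aCoeff_nonneg (n + 1)]

theorem aCoeff_succ_complex (n : ℕ) :
    2 * ((n + 1 : ℕ) : ℂ) * (aCoeff (n + 1) : ℂ) = (2 * n + 1) * (aCoeff n : ℂ) := by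
  exact_mod_cast congrArg (fun x : ℝ => (x : ℂ)) (aCoeff_succ n)

theorem PolyGrowth.aCoeff_mul {c : ℕ → ℂ} (hc : PolyGrowth c) :
    PolyGrowth fun n => (aCoeff n : ℂ) * c n := by
  refine hc.of_norm_le fun n => ?_
  rw [norm_mul, Complex.norm_real, Real.norm_of_nonneg (aCoeff_nonneg n)]
  exact mul_le_of_le_one_left (norm_nonneg _) (aCoeff_le_one n)

/-- The function `√(1 - x²) ∑ aₙ cₙ x²ⁿ` of `x = 2 u / (1 + u²)` is a level four polylogarithm of
weight `w` in `u`. -/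
def IsBinomialPolylog (w : ℕ) (c : ℕ → ℂ) : Prop :=
  PolyGrowth c ∧ ∃ d ∈ liSpan w, d 0 = c 0 ∧ ∀ u ∈ Set.Ioo (0 : ℝ) 1,
    (1 - (u : ℂ) ^ 2) / (1 + u ^ 2) * powerSum (fun n => aCoeff n * c n) (sinParam u ^ 2) =
      powerSum d u

theorem hasDerivAt_cosParam (u : ℝ) :
    HasDerivAt (fun u : ℝ => (1 - (u : ℂ) ^ 2) / (1 + u ^ 2)) (-(4 * (u : ℂ)) / (1 + u ^ 2) ^ 2) u := by
  have h := one_add_sq_ne_zero u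
  refine HasDerivAt.comp_ofReal (e := fun z : ℂ => (1 - z ^ 2) / (1 + z ^ 2)) ?_
  refine (((hasDerivAt_pow 2 (u : ℂ)).const_sub 1).div
    ((hasDerivAt_pow 2 (u : ℂ)).const_add 1) h).congr_deriv ?_
  field_simp
  ring

section

variable {b c : ℕ → ℂ} {u : ℝ}

/-- Here u stands for X = x². With G the series of a_n c_n and R that of 2n a_n b_n, this is (1 -
X)·2XG' - XG = R, obtained by applying the recurrence of a_n to the shifted sequence 2n a_n c_{n-1}.
-/
theorem powerSum_aCoeff_diff (hc : PolyGrowth c) (hb : PolyGrowth b)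
    (h : ∀ n, c (n + 1) = c n + b (n + 1)) (hu : |u| < 1) :
    2 * powerSum (fun n => n * (aCoeff n * c n)) u =
      powerSum (fun n => 2 * n * (aCoeff n * b n)) u +
        u * (2 * powerSum (fun n => n * (aCoeff n * c n)) u +
          powerSum (fun n => aCoeff n * c n) u) := by
  set s : ℕ → ℂ := fun n => 2 * n * (aCoeff n * c (n - 1)) with hs
  have hs1 : (fun n => s (n + 1)) = fun n => 2 * (n * (aCoeff n * c n)) + aCoeff n * c n := by
    ext n
    have := aCoeff_succ_complex n
    simp only [hs, Nat.add_sub_cancel]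
    linear_combination c n * this
  have hS : PolyGrowth s :=
    PolyGrowth.of_succ (hs1 ▸ (hc.aCoeff_mul.natCast_mul.const_mul 2).add hc.aCoeff_mul)
  have hR : PolyGrowth fun n => 2 * n * (aCoeff n * b n) := by
    simpa only [mul_assoc] using hb.aCoeff_mul.natCast_mul.const_mul 2
  have h1 := powerSum_eq_add hS hu
  have h0 : s 0 = 0 := by simp [hs]
  rw [hs1, h0, zero_add, powerSum_add (hc.aCoeff_mul.natCast_mul.const_mul 2) hc.aCoeff_mul hu,
    powerSum_const_mul] at h1
  rw [← h1, ← powerSum_add hR hS hu, ← powerSum_const_mul]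
  congr 1
  ext n
  rcases n with _ | n
  · simp [hs]
  · simp only [hs, Nat.add_sub_cancel, h n]
    ring

/-- √(1-x²) is the integrating factor: x d/dx of the product is R/√(1-x²), with R the series of 2n
a_n b_n, and dx/x = √(1-x²) du/u cancels the root. -/
theorem hasDerivAt_cosParam_mul (hc : PolyGrowth c) (hb : PolyGrowth b)
    (h : ∀ n, c (n + 1) = c n + b (n + 1)) (hu : u ∈ Set.Ioo (0 : ℝ) 1) :
    HasDerivAt (fun u : ℝ => (1 - (u : ℂ) ^ 2) / (1 + u ^ 2) *
        powerSum (fun n => aCoeff n * c n) (sinParam u ^ 2))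
      (powerSum (fun n => 2 * n * (aCoeff n * b n)) (sinParam u ^ 2) / u) u := by
  refine ((hasDerivAt_cosParam u).mul
    (hasDerivAt_powerSum_sinParam hc.aCoeff_mul hu)).congr_deriv ?_
  have key := powerSum_aCoeff_diff hc hb h (abs_lt_one_of_mem_Ioo (sinParam_sq_mem hu))
  have h3 := one_add_sq_ne_zero u
  have h4 : (u : ℂ) ≠ 0 := by exact_mod_cast hu.1.ne'
  have hX : ((sinParam u ^ 2 : ℝ) : ℂ) = 4 * u ^ 2 / (1 + u ^ 2) ^ 2 := by
    simp only [sinParam]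
    push_cast
    rw [div_pow]
    ring
  rw [hX] at key
  rw [eq_div_iff h4, eq_sub_of_add_eq key.symm]
  field_simp
  ring

theorem isBinomialPolylog_of_hasDerivAt {w : ℕ} {d : ℕ → ℂ} (hc : PolyGrowth c)
    (hb : PolyGrowth b) (h : ∀ n, c (n + 1) = c n + b (n + 1)) (hd : d ∈ liSpan w)
    (h0 : d 0 = c 0) (hderiv : ∀ u ∈ Set.Ioo (0 : ℝ) 1, HasDerivAt (powerSum d)
      (powerSum (fun n => 2 * n * (aCoeff n * b n)) (sinParam u ^ 2) / u) u) :
    IsBinomialPolylog w c := by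
  refine ⟨hc, d, hd, h0, eq_powerSum_of_hasDerivAt (polyGrowth_of_mem_liSpan hd)
    (fun u hu => hasDerivAt_cosParam_mul hc hb h hu) hderiv
    ((hasDerivAt_cosParam 0).continuousAt.mul
      (continuousAt_powerSum_sinParam hc.aCoeff_mul)) ?_⟩
  rw [powerSum_sinParam_zero, aCoeff_zero, h0]
  simp

theorem isBinomialPolylog_one : IsBinomialPolylog 0 fun _ => 1 := by
  refine isBinomialPolylog_of_hasDerivAt (b := fun _ => 0) (PolyGrowth.const 1)
    (PolyGrowth.const 0) (by simp) one_mem_liSpan (by simp) fun u hu => ?_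
  have h1 : powerSum (Pi.single 0 1) = fun _ => 1 := funext (powerSum_single 1)
  rw [h1]
  simpa [powerSum] using hasDerivAt_const u (1 : ℂ)

variable {w : ℕ}

theorem IsBinomialPolylog.add (hb : IsBinomialPolylog w b) (hc : IsBinomialPolylog w c) :
    IsBinomialPolylog w fun n => b n + c n := by
  obtain ⟨h1, d, hd, h2, h3⟩ := hb
  obtain ⟨h1', d', hd', h2', h3'⟩ := hc
  refine ⟨h1.add h1', d + d', Submodule.add_mem _ hd hd', by simp [h2, h2'], fun u hu => ?_⟩
  have e : powerSum (d + d') u = powerSum d u + powerSum d' u := powerSum_add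
    (polyGrowth_of_mem_liSpan hd) (polyGrowth_of_mem_liSpan hd') (abs_lt_one_of_mem_Ioo hu)
  rw [e, ← h3 u hu, ← h3' u hu, ← mul_add,
    ← powerSum_add h1.aCoeff_mul h1'.aCoeff_mul (abs_lt_one_of_mem_Ioo (sinParam_sq_mem hu))]
  simp only [mul_add]

theorem IsBinomialPolylog.sub (hb : IsBinomialPolylog w b) (hc : IsBinomialPolylog w c) :
    IsBinomialPolylog w fun n => b n - c n := by
  obtain ⟨h1, d, hd, h2, h3⟩ := hb
  obtain ⟨h1', d', hd', h2', h3'⟩ := hc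
  refine ⟨h1.sub h1', d - d', Submodule.sub_mem _ hd hd', by simp [h2, h2'], fun u hu => ?_⟩
  have e : powerSum (d - d') u = powerSum d u - powerSum d' u := powerSum_sub
    (polyGrowth_of_mem_liSpan hd) (polyGrowth_of_mem_liSpan hd') (abs_lt_one_of_mem_Ioo hu)
  rw [e, ← h3 u hu, ← h3' u hu, ← mul_sub,
    ← powerSum_sub h1.aCoeff_mul h1'.aCoeff_mul (abs_lt_one_of_mem_Ioo (sinParam_sq_mem hu))]
  simp only [mul_sub]

theorem two_smul_apply (d : ℕ → ℂ) : (2 : ℚ) • d = fun n => 2 * d n := by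
  ext n
  rw [Pi.smul_apply, Rat.smul_def]
  norm_num

theorem powerSum_div_natCast {g e : ℕ → ℂ} (hg : PolyGrowth g) (hg0 : g 0 = 0)
    (he : PolyGrowth e) (he0 : e 0 = 0)
    (h : ∀ u ∈ Set.Ioo (0 : ℝ) 1, powerSum g (sinParam u ^ 2) = powerSum e u) :
    ∀ u ∈ Set.Ioo (0 : ℝ) 1, powerSum (fun n => g n / n) (sinParam u ^ 2) =
      powerSum ((2 : ℚ) • intLog e) u := by
  have hg' : PolyGrowth fun n => g n / n := by simpa using hg.div_natCast_pow 1
  rw [two_smul_apply]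
  refine eq_powerSum_of_hasDerivAt (he.intLog.const_mul 2)
    (fun u hu => hasDerivAt_powerSum_sinParam hg' hu) (fun u hu => ?_)
    (continuousAt_powerSum_sinParam hg') ?_
  · refine (hasDerivAt_powerSum_const_mul 2 (hasDerivAt_intLog he he0 hu)).congr_deriv ?_
    rw [← h u hu, ← mul_assoc]
    congr 2
    ext n
    rcases n with _ | n
    · simp [hg0]
    · rw [mul_div_cancel₀ _ (Nat.cast_ne_zero.2 (Nat.succ_ne_zero n))]
  · simp [powerSum_sinParam_zero, intLog_apply_zero]

theorem sinParam_mul_powerSum_div_odd {g e : ℕ → ℂ} {a : ℂ} (hg : PolyGrowth g)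
    (he : PolyGrowth e) (he0 : e 0 = 0)
    (h : ∀ u ∈ Set.Ioo (0 : ℝ) 1, sinParam u * powerSum g (sinParam u ^ 2) = a * powerSum e u) :
    ∀ u ∈ Set.Ioo (0 : ℝ) 1, sinParam u * powerSum (fun n => g n / (2 * n + 1)) (sinParam u ^ 2) =
      a * powerSum (intLog e) u := by
  have hg' : PolyGrowth fun n => g n / (2 * n + 1) := by simpa using hg.div_odd_pow 1
  intro u hu
  rw [← powerSum_const_mul a (intLog e) u]
  revert u
  refine eq_powerSum_of_hasDerivAt (he.intLog.const_mul a)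
    (fun u hu => hasDerivAt_sinParam_mul_powerSum hg' hu) (fun u hu => ?_)
    ((Complex.continuous_ofReal.comp continuous_sinParam).continuousAt.mul
      (continuousAt_powerSum_sinParam hg')) ?_
  · refine (hasDerivAt_powerSum_const_mul a (hasDerivAt_intLog he he0 hu)).congr_deriv ?_
    have : (fun n : ℕ => (2 * (n : ℂ) + 1) * (g n / (2 * n + 1))) = g := by
      ext n
      have : (2 * (n : ℂ) + 1) ≠ 0 := by exact_mod_cast Nat.succ_ne_zero (2 * n)
      rw [mul_div_cancel₀ _ this]
    rw [this, h u hu]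
    ring
  · simp [sinParam, intLog_apply_zero]

/-! ### Dividing by powers of n and of 2n+1 -/

/-- With F = D/√(1-x²), the first division integrates (F - c_0) dx/x = (D - c_0) du/u + c_0·2u
du/(1+u²); the constant term must be split off to remove the pole at 0. Further divisions integrate
against dx/x directly. Each brings a factor 2 because the variable is x². -/
theorem IsBinomialPolylog.even_tail (hc : IsBinomialPolylog w c) (j : ℕ) :
    ∃ e ∈ convLiSpan (w + j + 1), e 0 = 0 ∧ ∀ u ∈ Set.Ioo (0 : ℝ) 1,
      powerSum (fun n => aCoeff n * c n / n ^ (j + 1)) (sinParam u ^ 2) = powerSum e u := by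
  obtain ⟨hg, d, hd, hd0, h⟩ := hc
  induction j with
  | zero =>
    have hdg := polyGrowth_of_mem_liSpan hd
    have hcg : PolyGrowth (constTerm d) := polyGrowth_single (d 0)
    refine ⟨(2 : ℚ) • (intZero d - intImSum (constTerm d)), Submodule.smul_mem _ _
      (Submodule.sub_mem _ (intZero_mem hd) (intImSum_mem (constTerm_mem hd))),
      by simp [intZero_apply_zero, intImSum_apply_zero], ?_⟩
    have hg' : PolyGrowth fun n => aCoeff n * c n / (n : ℂ) ^ (0 + 1) :=
      hg.aCoeff_mul.div_natCast_pow 1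
    rw [two_smul_apply]
    refine eq_powerSum_of_hasDerivAt ((hdg.intZero.sub hcg.intImSum).const_mul 2)
      (fun u hu => hasDerivAt_powerSum_sinParam hg' hu) (fun u hu => ?_)
      (continuousAt_powerSum_sinParam hg') ?_
    · have hu1 := abs_lt_one_of_mem_Ioo hu
      refine (hasDerivAt_powerSum_const_mul 2 (hasDerivAt_powerSum_sub hdg.intZero hcg.intImSum hu1
        (hasDerivAt_intZero hdg hu1 hu.1.ne') (hasDerivAt_intImSum hcg hu))).congr_deriv ?_
      have e1 : powerSum (fun n : ℕ => (n : ℂ) * (aCoeff n * c n / (n : ℂ) ^ (0 + 1)))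
          (sinParam u ^ 2) = powerSum (fun n => aCoeff n * c n) (sinParam u ^ 2) - c 0 := by
        rw [← powerSum_single (c 0) (sinParam u ^ 2), ← powerSum_sub hg.aCoeff_mul
          (polyGrowth_single _) (abs_lt_one_of_mem_Ioo (sinParam_sq_mem hu))]
        congr 1
        ext n
        rcases n with _ | n
        · simp [aCoeff_zero]
        · have : ((n + 1 : ℕ) : ℂ) ≠ 0 := Nat.cast_ne_zero.2 (by omega)
          simp only [zero_add, pow_one, mul_div_cancel₀ _ this]
          simp
      have e2 : powerSum (constTerm d) u = c 0 := by rw [← hd0]; exact powerSum_single _ _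
      rw [e1, e2, ← h u hu, hd0]
      have h3 := one_add_sq_ne_zero u
      have h4 : (u : ℂ) ≠ 0 := by exact_mod_cast hu.1.ne'
      field_simp
      ring
    · simp [powerSum_sinParam_zero, intZero_apply_zero, intImSum_apply_zero]
  | succ j ih =>
    obtain ⟨e, he, he0, h'⟩ := ih
    have he' := convLiSpan_le _ he
    refine ⟨(2 : ℚ) • intLog e, Submodule.smul_mem _ _ (intLog_mem he'),
      by simp [intLog_apply_zero], fun u hu => ?_⟩
    rw [← powerSum_div_natCast (hg.aCoeff_mul.div_natCast_pow (j + 1)) (by simp)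
      (polyGrowth_of_mem_liSpan he') he0 h' u hu]
    congr 1
    ext n
    rw [div_div, ← pow_succ]

/-- The extra factor x makes division by 2n+1 the inverse of x d/dx. The first step is F dx = D dθ =
D·2du/(1+u²), and -i undoes the i built into `intImDiff`; later steps use dx/x. -/
theorem IsBinomialPolylog.odd_tail (hc : IsBinomialPolylog w c) (j : ℕ) :
    ∃ e ∈ convLiSpan (w + j + 1), e 0 = 0 ∧ ∀ u ∈ Set.Ioo (0 : ℝ) 1,
      sinParam u * powerSum (fun n => aCoeff n * c n / (2 * n + 1) ^ (j + 1)) (sinParam u ^ 2) =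
        -Complex.I * powerSum e u := by
  obtain ⟨hg, d, hd, hd0, h⟩ := hc
  induction j with
  | zero =>
    have hdg := polyGrowth_of_mem_liSpan hd
    refine ⟨intImDiff d, intImDiff_mem hd, intImDiff_apply_zero d, fun u hu => ?_⟩
    have hg' : PolyGrowth fun n => aCoeff n * c n / (2 * (n : ℂ) + 1) ^ (0 + 1) :=
      hg.aCoeff_mul.div_odd_pow 1
    rw [← powerSum_const_mul (-Complex.I) (intImDiff d) u]
    revert u
    refine eq_powerSum_of_hasDerivAt (hdg.intImDiff.const_mul _)
      (fun u hu => hasDerivAt_sinParam_mul_powerSum hg' hu) (fun u hu => ?_)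
      ((Complex.continuous_ofReal.comp continuous_sinParam).continuousAt.mul
        (continuousAt_powerSum_sinParam hg')) ?_
    · refine (hasDerivAt_powerSum_const_mul _ (hasDerivAt_intImDiff hdg hu)).congr_deriv ?_
      have : (fun n : ℕ => (2 * (n : ℂ) + 1) * (aCoeff n * c n / (2 * n + 1) ^ (0 + 1))) =
          fun n => aCoeff n * c n := by
        ext n
        have : (2 * (n : ℂ) + 1) ≠ 0 := by exact_mod_cast Nat.succ_ne_zero (2 * n)
        rw [zero_add, pow_one, mul_div_cancel₀ _ this]
      rw [this, ← h u hu]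
      have h3 := one_add_sq_ne_zero u
      have h4 : (u : ℂ) ≠ 0 := by exact_mod_cast hu.1.ne'
      simp only [sinParam]
      push_cast
      rw [← mul_assoc (-Complex.I), neg_mul, Complex.I_mul_I, neg_neg]
      field_simp
    · simp [sinParam, intImDiff_apply_zero]
  | succ j ih =>
    obtain ⟨e, he, he0, h'⟩ := ih
    have he' := convLiSpan_le _ he
    refine ⟨intLog e, intLog_mem he', intLog_apply_zero e, fun u hu => ?_⟩
    rw [← sinParam_mul_powerSum_div_odd (hg.aCoeff_mul.div_odd_pow (j + 1))
      (polyGrowth_of_mem_liSpan he') he0 h' u hu]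
    congr 2
    ext n
    rw [div_div, ← pow_succ]

/-! ### Prepending an outer summation -/

/-- The derivative is 2/u times the series of a_n c_n/n^(s-1). For s ≥ 2 this is an even tail; for s
= 1 the identity (1+u²)/(u(1-u²)) = 1/u + 2u/(1-u²) applies, and the pole at u = 1 leads out of the
convergent span. The inner c is taken at the same index as the denominator, so the inequality is
weak, unlike in ζ_n. -/
theorem IsBinomialPolylog.sum_even (hc : IsBinomialPolylog w c) {s : ℕ} (hs : 0 < s) :
    IsBinomialPolylog (w + s)
      fun n => ∑ m ∈ Finset.range n, c (m + 1) / ((m + 1 : ℕ) : ℂ) ^ s := by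
  have hb := hc.1.div_natCast_pow s
  have hC := PolyGrowth.sum_range hb.succ
  obtain ⟨j, rfl⟩ := Nat.exists_eq_add_of_le' hs
  rcases j with _ | j
  · obtain ⟨hg, d, hd, hd0, h⟩ := hc
    have hdg := polyGrowth_of_mem_liSpan hd
    refine isBinomialPolylog_of_hasDerivAt (d := (2 : ℚ) • (intZero d + intReSum d)) hC hb
      (fun n => Finset.sum_range_succ _ n) (Submodule.smul_mem _ _
      (Submodule.add_mem _ (convLiSpan_le _ (intZero_mem hd)) (intReSum_mem hd)))
      (by simp [intZero_apply_zero, intReSum_apply_zero]) fun u hu => ?_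
    have hu1 := abs_lt_one_of_mem_Ioo hu
    rw [two_smul_apply]
    refine (hasDerivAt_powerSum_const_mul 2 (hasDerivAt_powerSum_add hdg.intZero hdg.intReSum hu1
      (hasDerivAt_intZero hdg hu1 hu.1.ne') (hasDerivAt_intReSum hdg hu))).congr_deriv ?_
    have e1 : powerSum (fun n : ℕ => 2 * (n : ℂ) * (aCoeff n * (c n / (n : ℂ) ^ (0 + 1))))
        (sinParam u ^ 2) = 2 * (powerSum (fun n => aCoeff n * c n) (sinParam u ^ 2) - c 0) := by
      rw [← powerSum_single (c 0) (sinParam u ^ 2), ← powerSum_sub hg.aCoeff_mul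
        (polyGrowth_single _) (abs_lt_one_of_mem_Ioo (sinParam_sq_mem hu)), ← powerSum_const_mul]
      congr 1
      ext n
      rcases n with _ | n
      · simp [aCoeff_zero]
      · have : ((n + 1 : ℕ) : ℂ) ≠ 0 := Nat.cast_ne_zero.2 (by omega)
        simp only [zero_add, pow_one]
        field_simp
        simp
    rw [zero_add] at e1 ⊢
    rw [e1, ← h u hu, hd0]
    have h3 := one_add_sq_ne_zero u
    have h4 : (u : ℂ) ≠ 0 := by exact_mod_cast hu.1.ne'
    have h5 := one_sub_sq_ne_zero hu
    field_simp
    ring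
  · obtain ⟨e, he, he0, h⟩ := hc.even_tail j
    have he' := convLiSpan_le _ he
    have heg := polyGrowth_of_mem_liSpan he'
    refine isBinomialPolylog_of_hasDerivAt (d := (2 : ℚ) • intZero e) hC hb
      (fun n => Finset.sum_range_succ _ n) (Submodule.smul_mem _ _
      (convLiSpan_le _ (intZero_mem he')))
      (by simp [intZero_apply_zero]) fun u hu => ?_
    rw [two_smul_apply]
    refine (hasDerivAt_powerSum_const_mul 2
      (hasDerivAt_intZero heg (abs_lt_one_of_mem_Ioo hu) hu.1.ne')).congr_deriv ?_
    rw [← h u hu, he0, sub_zero, ← mul_div_assoc, ← powerSum_const_mul]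
    congr 2
    ext n
    rcases n with _ | n
    · simp
    · have : ((n + 1 : ℕ) : ℂ) ≠ 0 := Nat.cast_ne_zero.2 (by omega)
      field_simp
      rw [mul_assoc (_ * _) _ ((n + 1 : ℕ) : ℂ), ← pow_succ]

/-- The increment at n is c_{n-1}/(2n-1)^s, and 2n a_n = (2n-1)a_{n-1} cancels one power, leaving x²
times a series with exponent s-1. For s ≥ 2 use x/u = 2/(1+u²) on the odd tail; for s = 1 use
4u/((1+u²)(1-u²)) = 2u/(1-u²) + 2u/(1+u²). Here the inequality is strict, as in t_n. -/
theorem IsBinomialPolylog.sum_odd (hc : IsBinomialPolylog w c) {s : ℕ} (hs : 0 < s) :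
    IsBinomialPolylog (w + s) fun n => ∑ m ∈ Finset.range n, c m / (2 * (m : ℂ) + 1) ^ s := by
  have hb' := hc.1.div_odd_pow s
  have hC := PolyGrowth.sum_range hb'
  -- Truncated subtraction gives b 0 a junk value, harmless because b enters only through n b_n.
  set b : ℕ → ℂ := fun n => c (n - 1) / (2 * ((n - 1 : ℕ) : ℂ) + 1) ^ s with hbdef
  have hb : PolyGrowth b := PolyGrowth.of_succ hb'
  obtain ⟨j, rfl⟩ := Nat.exists_eq_add_of_le' hs
  have hR : PolyGrowth fun n => 2 * n * (aCoeff n * b n) := by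
    simpa only [mul_assoc] using hb.aCoeff_mul.natCast_mul.const_mul 2
  have key : ∀ u ∈ Set.Ioo (0 : ℝ) 1,
      powerSum (fun n => 2 * n * (aCoeff n * b n)) (sinParam u ^ 2) =
        sinParam u ^ 2 * powerSum (fun n => aCoeff n * c n / (2 * n + 1) ^ j) (sinParam u ^ 2) := by
    intro u hu
    rw [powerSum_eq_add hR (abs_lt_one_of_mem_Ioo (sinParam_sq_mem hu))]
    simp only [Nat.cast_zero, mul_zero, zero_mul, zero_add, Complex.ofReal_pow]
    congr 2
    ext n
    have h1 : (2 * (n : ℂ) + 1) ≠ 0 := by exact_mod_cast Nat.succ_ne_zero (2 * n)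
    simp only [hbdef, Nat.add_sub_cancel]
    rw [← mul_assoc, aCoeff_succ_complex, pow_succ]
    field_simp
  rcases j with _ | j
  · obtain ⟨hg, d, hd, hd0, h⟩ := hc
    have hdg := polyGrowth_of_mem_liSpan hd
    refine isBinomialPolylog_of_hasDerivAt (d := intReSum d - intImSum d) hC hb
      (fun n => Finset.sum_range_succ _ n)
      (Submodule.sub_mem _ (intReSum_mem hd) (convLiSpan_le _ (intImSum_mem hd)))
      (by simp [intImSum_apply_zero, intReSum_apply_zero]) fun u hu => ?_
    have hu1 := abs_lt_one_of_mem_Ioo hu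
    refine (hasDerivAt_powerSum_sub hdg.intReSum hdg.intImSum hu1
      (hasDerivAt_intReSum hdg hu) (hasDerivAt_intImSum hdg hu)).congr_deriv ?_
    rw [key u hu, ← h u hu]
    simp only [pow_zero, div_one]
    have h3 := one_add_sq_ne_zero u
    have h4 : (u : ℂ) ≠ 0 := by exact_mod_cast hu.1.ne'
    have h5 := one_sub_sq_ne_zero hu
    simp only [sinParam]
    push_cast
    field_simp
    ring
  · obtain ⟨e, he, he0, h⟩ := hc.odd_tail j
    have he' := convLiSpan_le _ he
    have heg := polyGrowth_of_mem_liSpan he'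
    refine isBinomialPolylog_of_hasDerivAt (d := -intImDiff e) hC hb
      (fun n => Finset.sum_range_succ _ n)
      (Submodule.neg_mem _ (convLiSpan_le _ (intImDiff_mem he')))
      (by simp [intImDiff_apply_zero]) fun u hu => ?_
    have e1 : -intImDiff e = fun n => (-1) * intImDiff e n := by ext n; simp
    rw [e1]
    refine (hasDerivAt_powerSum_const_mul (-1) (hasDerivAt_intImDiff heg hu)).congr_deriv ?_
    rw [key u hu, pow_two (sinParam u : ℂ), mul_assoc, h u hu]
    have h3 := one_add_sq_ne_zero u
    have h4 : (u : ℂ) ≠ 0 := by exact_mod_cast hu.1.ne'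
    simp only [sinParam]
    push_cast
    field_simp

end

/-! ### Products of multiple harmonic sums -/

theorem nestedSum_cons {R : Type*} [CommSemiring R] (f : ℕ → R) (fs : List (ℕ → R)) (n : ℕ) :
    nestedSum (f :: fs) (n + 1) = ∑ m ∈ Finset.range n, f (m + 1) * nestedSum fs (m + 1) := by
  rw [nestedSum, Finset.range_eq_Ico, Finset.sum_Ico_add' (fun m => f m * nestedSum fs m)]

theorem zetaSum_cons (s : ℕ) (k : List ℕ) (n : ℕ) :
    zetaSum (s :: k) n = ∑ m ∈ Finset.range n, zetaSum k m / ((m + 1 : ℕ) : ℝ) ^ s := by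
  rw [zetaSum, List.map_cons, nestedSum_cons]
  exact Finset.sum_congr rfl fun m _ => by rw [one_div_mul_eq_div]; rfl

theorem tSum_cons (s : ℕ) (l : List ℕ) (n : ℕ) :
    tSum (s :: l) n = ∑ m ∈ Finset.range n, tSum l m / (2 * (m : ℝ) + 1) ^ s := by
  rw [tSum, List.map_cons, nestedSum_cons]
  refine Finset.sum_congr rfl fun m _ => ?_
  have : 2 * ((m + 1 : ℕ) : ℝ) - 1 = 2 * m + 1 := by push_cast; ring
  rw [this, one_div_mul_eq_div]
  rfl

theorem zetaSum_nonneg (k : List ℕ) (n : ℕ) : 0 ≤ zetaSum k n := by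
  induction k generalizing n with
  | nil => exact zero_le_one
  | cons s k ih =>
    rw [zetaSum_cons]
    exact Finset.sum_nonneg fun m _ => div_nonneg (ih m) (by positivity)

theorem tSum_nonneg (l : List ℕ) (n : ℕ) : 0 ≤ tSum l n := by
  induction l generalizing n with
  | nil => exact zero_le_one
  | cons s k ih =>
    rw [tSum_cons]
    exact Finset.sum_nonneg fun m _ => div_nonneg (ih m) (by positivity)

theorem zetaSum_nil (n : ℕ) : zetaSum [] n = 1 := rfl

theorem tSum_nil (n : ℕ) : tSum [] n = 1 := rfl

theorem zetaSum_cons_succ (s : ℕ) (k : List ℕ) (n : ℕ) :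
    zetaSum (s :: k) (n + 1) = zetaSum (s :: k) n + zetaSum k n / ((n + 1 : ℕ) : ℝ) ^ s := by
  rw [zetaSum_cons, zetaSum_cons, Finset.sum_range_succ]

theorem tSum_cons_succ (s : ℕ) (l : List ℕ) (n : ℕ) :
    tSum (s :: l) (n + 1) = tSum (s :: l) n + tSum l n / (2 * (n : ℝ) + 1) ^ s := by
  rw [tSum_cons, tSum_cons, Finset.sum_range_succ]

theorem IsBinomialPolylog.congr {w w' : ℕ} {c c' : ℕ → ℂ} (h : IsBinomialPolylog w c)
    (hw : w = w') (hc : ∀ n, c n = c' n) : IsBinomialPolylog w' c' := by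
  obtain rfl := funext hc
  exact hw ▸ h

/-- The second family, with ζ strictly below m and t up to m, is what arises when a product is split
by its largest index. The increment of AB is (ΔA)B_{n+1} + A_n ΔB: the first part is in the second
family for a shorter k, the second is handled by `IsBinomialPolylog.sum_odd`. The second family for
k₁ :: k is in turn a weak sum from `IsBinomialPolylog.sum_even` minus its diagonal, which has
exponent s + k₁ and shorter k. -/
theorem isBinomialPolylog_mul_and_sum (k : List ℕ) (hk : ∀ s ∈ k, 0 < s) :
    (∀ l : List ℕ, (∀ s ∈ l, 0 < s) →
      IsBinomialPolylog (k.sum + l.sum) fun n => (zetaSum k n : ℂ) * tSum l n) ∧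
    ∀ l : List ℕ, (∀ s ∈ l, 0 < s) → ∀ s, 0 < s →
      IsBinomialPolylog (k.sum + l.sum + s) fun n => ∑ m ∈ Finset.range n,
        (zetaSum k m : ℂ) * tSum l (m + 1) / ((m + 1 : ℕ) : ℂ) ^ s := by
  induction k with
  | nil =>
    have h : ∀ l : List ℕ, (∀ s ∈ l, 0 < s) →
        IsBinomialPolylog (([] : List ℕ).sum + l.sum) fun n => (zetaSum [] n : ℂ) * tSum l n := by
      intro l
      induction l with
      | nil =>
        intro _
        simpa [zetaSum_nil, tSum_nil] using isBinomialPolylog_one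
      | cons s l ih =>
        intro hl
        refine ((ih fun t ht => hl t (by simp [ht])).sum_odd (hl s (by simp))).congr
          (by simp only [List.sum_cons]; omega) fun n => ?_
        simp only [tSum_cons, zetaSum_nil]
        push_cast
        simp
    refine ⟨h, fun l hl s hs => ?_⟩
    simpa only [zetaSum_nil] using (h l hl).sum_even hs
  | cons k₁ k ih =>
    obtain ⟨-, ih₂⟩ := ih fun t ht => hk t (by simp [ht])
    have hk₁ : 0 < k₁ := hk k₁ (by simp)
    have h : ∀ l : List ℕ, (∀ s ∈ l, 0 < s) → IsBinomialPolylog ((k₁ :: k).sum + l.sum)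
        fun n => (zetaSum (k₁ :: k) n : ℂ) * tSum l n := by
      intro l
      induction l with
      | nil =>
        intro hl
        refine (ih₂ [] hl k₁ hk₁).congr (by simp only [List.sum_cons]; omega) fun n => ?_
        simp only [zetaSum_cons, tSum_nil]
        push_cast
        simp
      | cons s l ihl =>
        intro hl
        have h₁ := (ih₂ (s :: l) hl k₁ hk₁).congr
          (w' := (k₁ :: k).sum + (s :: l).sum) (by simp only [List.sum_cons]; omega) fun _ => rfl
        have h₂ := ((ihl fun t ht => hl t (by simp [ht])).sum_odd (hl s (by simp))).congr
          (w' := (k₁ :: k).sum + (s :: l).sum) (by simp only [List.sum_cons]; omega) fun _ => rfl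
        refine (h₁.add h₂).congr rfl fun n => ?_
        induction n with
        | zero => simp [zetaSum_cons]
        | succ n ih =>
          rw [Finset.sum_range_succ, Finset.sum_range_succ, add_add_add_comm, ih,
            zetaSum_cons_succ, tSum_cons_succ]
          push_cast
          ring
    refine ⟨h, fun l hl s hs => ?_⟩
    have h₁ := (h l hl).sum_even hs
    have h₂ := (ih₂ l hl (s + k₁) (by omega)).congr (w' := (k₁ :: k).sum + l.sum + s)
      (by simp only [List.sum_cons]; omega) fun _ => rfl
    refine (h₁.sub h₂).congr rfl fun n => ?_
    rw [← Finset.sum_sub_distrib]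
    refine Finset.sum_congr rfl fun m _ => ?_
    have hm : ((m + 1 : ℕ) : ℂ) ≠ 0 := Nat.cast_ne_zero.2 (by omega)
    rw [zetaSum_cons_succ, pow_add]
    push_cast at hm ⊢
    field_simp
    ring

/-! ### Passage to the endpoint -/

/-- By nonnegativity every partial sum of e is at most the limit of g, so e is summable; e then
dominates the terms and the limit passes inside. No asymptotics of a_n are needed. -/
theorem hasSum_of_tendsto_of_nonneg {d : ℝ → ℕ → ℝ} {e : ℕ → ℝ} {g : ℝ → ℂ} {c : ℂ}
    (h0 : ∀ u ∈ Set.Ioo (0 : ℝ) 1, ∀ n, 0 ≤ d u n) (hle : ∀ u ∈ Set.Ioo (0 : ℝ) 1, ∀ n, d u n ≤ e n)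
    (hlim : ∀ n, Filter.Tendsto (fun u => d u n) (nhdsWithin 1 (Set.Iio 1)) (nhds (e n)))
    (hsum : ∀ u ∈ Set.Ioo (0 : ℝ) 1, HasSum (fun n => (d u n : ℂ)) (g u))
    (hg : Filter.Tendsto g (nhdsWithin 1 (Set.Iio 1)) (nhds c)) :
    HasSum (fun n => (e n : ℂ)) c := by
  have hmem : ∀ᶠ u : ℝ in nhdsWithin 1 (Set.Iio 1), u ∈ Set.Ioo (0 : ℝ) 1 :=
    Ioo_mem_nhdsLT (zero_lt_one' ℝ)
  have he0 : ∀ n, 0 ≤ e n := fun n =>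
    (h0 (1 / 2) (by norm_num) n).trans (hle (1 / 2) (by norm_num) n)
  have he : Summable e := by
    refine summable_of_sum_range_le (c := c.re) he0 fun N => ?_
    refine le_of_tendsto_of_tendsto (tendsto_finsetSum _ fun n _ => hlim n)
      ((Complex.continuous_re.tendsto c).comp hg) ?_
    filter_upwards [hmem] with u hu
    have h1 := Complex.hasSum_re (hsum u hu)
    exact sum_le_hasSum _ (fun n _ => h0 u hu n) (by simpa using h1)
  have hlim' : Filter.Tendsto (fun u => ∑' n, (d u n : ℂ)) (nhdsWithin 1 (Set.Iio 1))
      (nhds (∑' n, (e n : ℂ))) := by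
    refine tendsto_tsum_of_dominated_convergence he
      (fun n => (Complex.continuous_ofReal.tendsto _).comp (hlim n)) ?_
    filter_upwards [hmem] with u hu n
    rw [Complex.norm_real, Real.norm_of_nonneg (h0 u hu n)]
    exact hle u hu n
  have hg' : Filter.Tendsto g (nhdsWithin 1 (Set.Iio 1)) (nhds (∑' n, (e n : ℂ))) := by
    refine hlim'.congr' ?_
    filter_upwards [hmem] with u hu
    exact (hsum u hu).tsum_eq
  rw [tendsto_nhds_unique hg hg']
  exact (Complex.hasSum_ofReal.2 he.hasSum).summable.hasSum

/-! ### Sine power integrals -/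

/-- The integral of `sin ^ (2 n)` from `0` to `2 arctan u`. -/
noncomputable def sinPowIntegral (n : ℕ) (u : ℝ) : ℝ :=
  ∫ θ in (0 : ℝ)..2 * Real.arctan u, Real.sin θ ^ (2 * n)

theorem sin_two_mul_arctan (u : ℝ) : Real.sin (2 * Real.arctan u) = sinParam u := by
  have h : (0 : ℝ) < 1 + u ^ 2 := by positivity
  have h2 := Real.mul_self_sqrt h.le
  rw [Real.sin_two_mul, Real.sin_arctan, Real.cos_arctan, sinParam, mul_one_div, mul_div_assoc',
    div_div, h2]

theorem hasDerivAt_sinPowIntegral (n : ℕ) (u : ℝ) :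
    HasDerivAt (sinPowIntegral n) (2 / (1 + u ^ 2) * (sinParam u ^ 2) ^ n) u := by
  have hc : Continuous fun θ : ℝ => Real.sin θ ^ (2 * n) := Real.continuous_sin.pow _
  have h1 := (hc.integral_hasStrictDerivAt 0 (2 * Real.arctan u)).hasDerivAt
  refine (h1.comp u ((Real.hasDerivAt_arctan u).const_mul 2)).congr_deriv ?_
  rw [sin_two_mul_arctan, pow_mul]
  ring

theorem sinPowIntegral_zero (n : ℕ) : sinPowIntegral n 0 = 0 := by simp [sinPowIntegral]

theorem sinPowIntegral_le {u v : ℝ} (hu : 0 ≤ u) (huv : u ≤ v) (n : ℕ) :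
    sinPowIntegral n u ≤ sinPowIntegral n v := by
  have hc : Continuous fun θ : ℝ => Real.sin θ ^ (2 * n) := Real.continuous_sin.pow _
  refine intervalIntegral.integral_mono_interval le_rfl ?_ ?_ ?_ (hc.intervalIntegrable _ _)
  · have := Real.arctan_nonneg.2 hu
    positivity
  · have := Real.arctan_strictMono.monotone huv
    linarith
  · exact Filter.Eventually.of_forall fun θ => (even_two_mul n).pow_nonneg _

theorem sinPowIntegral_nonneg {u : ℝ} (hu : 0 ≤ u) (n : ℕ) : 0 ≤ sinPowIntegral n u := by
  rw [← sinPowIntegral_zero n]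
  exact sinPowIntegral_le le_rfl hu n

/-- Wallis's formula: the reduction formula for sine powers is the recurrence of a_n. -/
theorem sinPowIntegral_one (n : ℕ) : sinPowIntegral n 1 = Real.pi / 2 * aCoeff n := by
  have hpi : 2 * Real.arctan 1 = Real.pi / 2 := by rw [Real.arctan_one]; ring
  rw [sinPowIntegral, hpi]
  induction n with
  | zero => simp [aCoeff_zero]
  | succ n ih =>
    have h := aCoeff_succ n
    have h1 : (0 : ℝ) < 2 * n + 2 := by positivity
    rw [show 2 * (n + 1) = 2 * n + 2 by ring, integral_sin_pow, ih]
    simp only [Real.sin_zero, Real.cos_pi_div_two]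
    push_cast
    field_simp
    simp
    linear_combination (-Real.pi) * h

theorem sinParam_sq_le {v r : ℝ} (hv : |v| ≤ r) (hr : r ≤ 1) : sinParam v ^ 2 ≤ sinParam r ^ 2 := by
  have hr0 : 0 ≤ r := (abs_nonneg v).trans hv
  have h1 : sinParam v ^ 2 = sinParam |v| ^ 2 := by simp [sinParam, div_pow, mul_pow]
  have h2 : 0 ≤ sinParam |v| := by unfold sinParam; positivity
  have h3 : 0 ≤ |v| := abs_nonneg v
  rw [h1]
  refine pow_le_pow_left₀ h2 ?_ 2
  rw [sinParam, sinParam, div_le_div_iff₀ (by positivity) (by positivity)]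
  -- The cross-multiplied difference is 2(r - |v|)(1 - r|v|).
  have h4 : 0 ≤ (r - |v|) * (1 - r * |v|) :=
    mul_nonneg (sub_nonneg.2 hv) (by nlinarith)
  nlinarith

/-- Termwise integration in θ: the differentiated series is dominated on (-r, r) by its value at r,
and both sides vanish at 0. The point u = 0 is included in `key` for continuity there. -/
theorem hasSum_mul_sinPowIntegral {f E : ℕ → ℂ} (hf : PolyGrowth f) (hE : PolyGrowth E)
    (hE0 : E 0 = 0) (h : ∀ u ∈ Set.Ioo (0 : ℝ) 1,
      HasDerivAt (powerSum E) (2 / (1 + u ^ 2) * powerSum f (sinParam u ^ 2)) u) :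
    ∀ u ∈ Set.Ioo (0 : ℝ) 1, HasSum (fun n => f n * (sinPowIntegral n u : ℂ)) (powerSum E u) := by
  have key : ∀ u ∈ Set.Ico (0 : ℝ) 1, Summable (fun n => f n * (sinPowIntegral n u : ℂ)) ∧
      HasDerivAt (fun u => ∑' n, f n * (sinPowIntegral n u : ℂ))
        (2 / (1 + u ^ 2) * powerSum f (sinParam u ^ 2)) u := by
    intro u hu
    obtain ⟨r, hur, hr1⟩ := exists_between hu.2
    have hr0 : 0 < r := hu.1.trans_lt hur
    have hX := sinParam_sq_mem ⟨hr0, hr1⟩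
    have hs : Summable fun n => 2 * ‖f n * ((sinParam r ^ 2 : ℝ) : ℂ) ^ n‖ :=
      (hf.summable_norm (abs_lt_one_of_mem_Ioo hX)).mul_left 2
    have hd : ∀ n, ∀ v ∈ Set.Ioo (-r) r, HasDerivAt (fun v => f n * (sinPowIntegral n v : ℂ))
        (f n * ((2 / (1 + v ^ 2) * (sinParam v ^ 2) ^ n : ℝ) : ℂ)) v := fun n v _ =>
      (hasDerivAt_sinPowIntegral n v).ofReal_comp.const_mul (f n)
    have hb : ∀ n, ∀ v ∈ Set.Ioo (-r) r,
        ‖f n * ((2 / (1 + v ^ 2) * (sinParam v ^ 2) ^ n : ℝ) : ℂ)‖ ≤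
          2 * ‖f n * ((sinParam r ^ 2 : ℝ) : ℂ) ^ n‖ := by
      intro n v hv
      have h1 := sinParam_sq_le (abs_lt.2 hv).le hr1.le
      have h2 : 2 / (1 + v ^ 2) ≤ 2 := div_le_self zero_le_two (by nlinarith [sq_nonneg v])
      rw [norm_mul, norm_mul, norm_pow, Complex.norm_real, Complex.norm_real,
        Real.norm_of_nonneg (by positivity), Real.norm_of_nonneg (by positivity)]
      calc _ ≤ ‖f n‖ * (2 * (sinParam r ^ 2) ^ n) := by gcongr
        _ = _ := by ring
    have hu' : u ∈ Set.Ioo (-r) r := ⟨by linarith [hu.1], hur⟩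
    have h0 : (0 : ℝ) ∈ Set.Ioo (-r) r := ⟨by linarith, hr0⟩
    have hs0 : Summable fun n => f n * (sinPowIntegral n 0 : ℂ) := by
      simp [sinPowIntegral_zero]
    refine ⟨summable_of_summable_hasDerivAt_of_isPreconnected hs isOpen_Ioo isPreconnected_Ioo hd hb
      h0 hs0 hu', (hasDerivAt_tsum_of_isPreconnected hs isOpen_Ioo isPreconnected_Ioo hd hb h0 hs0
      hu').congr_deriv ?_⟩
    rw [powerSum, ← tsum_mul_left]
    refine tsum_congr fun n => ?_
    push_cast
    ring
  intro u hu
  have e := eq_powerSum_of_hasDerivAt hE (fun u hu => (key u ⟨hu.1.le, hu.2⟩).2) h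
    (key 0 (by simp)).2.continuousAt (by simp [sinPowIntegral_zero, hE0]) u hu
  rw [← e]
  exact (key u ⟨hu.1.le, hu.2⟩).1.hasSum

theorem tendsto_sinParam : Filter.Tendsto sinParam (nhdsWithin 1 (Set.Iio 1)) (nhds 1) := by
  have h := (continuous_sinParam.tendsto 1).mono_left
    (nhdsWithin_le_nhds (a := (1 : ℝ)) (s := Set.Iio 1))
  have h1 : sinParam 1 = 1 := by norm_num [sinParam]
  rwa [h1] at h

theorem tendsto_sinPowIntegral (n : ℕ) : Filter.Tendsto (sinPowIntegral n)
    (nhdsWithin 1 (Set.Iio 1)) (nhds (Real.pi / 2 * aCoeff n)) := by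
  rw [← sinPowIntegral_one]
  exact (hasDerivAt_sinPowIntegral n 1).continuousAt.tendsto.mono_left nhdsWithin_le_nhds

/-! ### The four kinds of series -/

section

variable {w : ℕ} {c : ℕ → ℝ}

theorem hasSum_aCoeff_div_pow (h0 : ∀ n, 0 ≤ c n) (hc : IsBinomialPolylog w fun n => (c n : ℂ))
    (j : ℕ) : ∃ x ∈ CMZV 4 (w + j + 1),
      HasSum (fun n : ℕ => ((aCoeff n * c n / (n : ℝ) ^ (j + 1) : ℝ) : ℂ)) x := by
  obtain ⟨e, he, -, h⟩ := hc.even_tail j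
  obtain ⟨x, hx, hlim⟩ := tendsto_powerSum_of_mem he
  have hpos : ∀ n : ℕ, 0 ≤ aCoeff n * c n / (n : ℝ) ^ (j + 1) := fun n =>
    div_nonneg (mul_nonneg (aCoeff_nonneg n) (h0 n)) (by positivity)
  refine ⟨x, hx, hasSum_of_tendsto_of_nonneg (g := powerSum e)
    (d := fun u n => aCoeff n * c n / (n : ℝ) ^ (j + 1) * (sinParam u ^ 2) ^ n)
    (fun u hu n => mul_nonneg (hpos n) (pow_nonneg (sinParam_sq_mem hu).1.le n))
    (fun u hu n => mul_le_of_le_one_right (hpos n)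
      (pow_le_one₀ (sinParam_sq_mem hu).1.le (sinParam_sq_mem hu).2.le))
    (fun n => ?_) (fun u hu => ?_) hlim⟩
  · simpa using ((tendsto_sinParam.pow 2).pow n).const_mul (aCoeff n * c n / (n : ℝ) ^ (j + 1))
  · rw [← h u hu]
    convert (hc.1.aCoeff_mul.div_natCast_pow (j + 1)).hasSum
      (abs_lt_one_of_mem_Ioo (sinParam_sq_mem hu)) using 2 with n
    push_cast
    rfl

theorem hasSum_aCoeff_div_odd_pow (h0 : ∀ n, 0 ≤ c n)
    (hc : IsBinomialPolylog w fun n => (c n : ℂ)) (j : ℕ) : ∃ x ∈ CMZV 4 (w + j + 1),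
      HasSum (fun n : ℕ => ((aCoeff n * c n / (2 * (n : ℝ) + 1) ^ (j + 1) : ℝ) : ℂ))
        (Complex.I * x) := by
  obtain ⟨e, he, -, h⟩ := hc.odd_tail j
  obtain ⟨x, hx, hlim⟩ := tendsto_powerSum_of_mem he
  have hpos : ∀ n : ℕ, 0 ≤ aCoeff n * c n / (2 * (n : ℝ) + 1) ^ (j + 1) := fun n =>
    div_nonneg (mul_nonneg (aCoeff_nonneg n) (h0 n)) (by positivity)
  refine ⟨-x, Submodule.neg_mem _ hx, hasSum_of_tendsto_of_nonneg
    (g := fun u => -Complex.I * powerSum e u)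
    (d := fun u n => aCoeff n * c n / (2 * (n : ℝ) + 1) ^ (j + 1) *
      (sinParam u * (sinParam u ^ 2) ^ n))
    (fun u hu n => mul_nonneg (hpos n)
      (mul_nonneg (sinParam_mem hu).1.le (pow_nonneg (sinParam_sq_mem hu).1.le n)))
    (fun u hu n => mul_le_of_le_one_right (hpos n)
      (mul_le_one₀ (sinParam_mem hu).2.le (pow_nonneg (sinParam_sq_mem hu).1.le n)
        (pow_le_one₀ (sinParam_sq_mem hu).1.le (sinParam_sq_mem hu).2.le)))
    (fun n => ?_) (fun u hu => ?_) ?_⟩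
  · simpa using (tendsto_sinParam.mul ((tendsto_sinParam.pow 2).pow n)).const_mul
      (aCoeff n * c n / (2 * (n : ℝ) + 1) ^ (j + 1))
  · simp only [← h u hu]
    refine (congrArg (HasSum · _) (funext fun n => ?_)).mpr
      (((hc.1.aCoeff_mul.div_odd_pow (j + 1)).hasSum
      (abs_lt_one_of_mem_Ioo (sinParam_sq_mem hu))).mul_left (sinParam u : ℂ))
    push_cast
    ring
  · simpa using hlim.const_mul (-Complex.I)

/-- At u = 1 the integrated series is (π/2) ∑ a_n f_n, so (2/π)(-i) = (i/π)(-2) accounts for the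
factor -2 in the witness. -/
theorem hasSum_aCoeff_mul_of_hasDerivAt {f : ℕ → ℝ} {E : ℕ → ℂ} (h0 : ∀ n, 0 ≤ f n)
    (hf : PolyGrowth fun n => (f n : ℂ)) (hE : E ∈ convLiSpan w) (hE0 : E 0 = 0)
    (h : ∀ u ∈ Set.Ioo (0 : ℝ) 1, HasDerivAt (powerSum fun n => -Complex.I * E n)
      (2 / (1 + u ^ 2) * powerSum (fun n => (f n : ℂ)) (sinParam u ^ 2)) u) :
    ∃ x ∈ CMZV 4 w,
      HasSum (fun n => ((aCoeff n * f n : ℝ) : ℂ)) (Complex.I / (Real.pi : ℂ) * x) := by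
  obtain ⟨x, hx, hlim⟩ := tendsto_powerSum_of_mem hE
  have hEg := polyGrowth_of_mem_liSpan (convLiSpan_le _ hE)
  refine ⟨(-2 : ℚ) • x, Submodule.smul_mem _ _ hx, ?_⟩
  have key := hasSum_of_tendsto_of_nonneg (g := fun u => -Complex.I * powerSum E u)
    (c := -Complex.I * x) (d := fun u n => f n * sinPowIntegral n u)
    (e := fun n => f n * (Real.pi / 2 * aCoeff n))
    (fun u hu n => mul_nonneg (h0 n) (sinPowIntegral_nonneg hu.1.le n))
    (fun u hu n => ?_) (fun n => (tendsto_sinPowIntegral n).const_mul _) (fun u hu => ?_)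
    (hlim.const_mul _)
  · have hpi : (Real.pi : ℂ) ≠ 0 := by exact_mod_cast Real.pi_ne_zero
    have e₁ : (fun n => ((aCoeff n * f n : ℝ) : ℂ)) =
        fun n => 2 / (Real.pi : ℂ) * ((f n * (Real.pi / 2 * aCoeff n) : ℝ) : ℂ) := by
      ext n
      push_cast
      field_simp
    have e₂ : Complex.I / (Real.pi : ℂ) * ((-2 : ℚ) • x) =
        2 / (Real.pi : ℂ) * (-Complex.I * x) := by
      rw [Rat.smul_def]
      push_cast
      ring
    rw [e₁, e₂]
    exact key.mul_left _
  · rw [← sinPowIntegral_one]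
    exact mul_le_mul_of_nonneg_left (sinPowIntegral_le hu.1.le hu.2.le n) (h0 n)
  · have := hasSum_mul_sinPowIntegral hf (hEg.const_mul (-Complex.I)) (by simp [hE0]) h u hu
    rw [powerSum_const_mul] at this
    exact_mod_cast this

theorem hasSum_aCoeff_sq_div_pow (h0 : ∀ n, 0 ≤ c n)
    (hc : IsBinomialPolylog w fun n => (c n : ℂ)) (j : ℕ) : ∃ x ∈ CMZV 4 (w + j + 2),
      HasSum (fun n : ℕ => ((aCoeff n ^ 2 * c n / (n : ℝ) ^ (j + 1) : ℝ) : ℂ))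
        (Complex.I / (Real.pi : ℂ) * x) := by
  obtain ⟨e, he, -, h⟩ := hc.even_tail j
  have he' := convLiSpan_le _ he
  have hf : (fun n : ℕ => ((aCoeff n * c n / (n : ℝ) ^ (j + 1) : ℝ) : ℂ)) =
      fun n => aCoeff n * c n / (n : ℂ) ^ (j + 1) := by
    ext n
    push_cast
    rfl
  have hderiv : ∀ u ∈ Set.Ioo (0 : ℝ) 1, HasDerivAt (powerSum fun n => -Complex.I * intImDiff e n)
      (2 / (1 + u ^ 2) * powerSum (fun n : ℕ =>
        ((aCoeff n * c n / (n : ℝ) ^ (j + 1) : ℝ) : ℂ)) (sinParam u ^ 2)) u := by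
    intro u hu
    rw [hf, h u hu]
    refine (hasDerivAt_powerSum_const_mul (-Complex.I)
      (hasDerivAt_intImDiff (polyGrowth_of_mem_liSpan he') hu)).congr_deriv ?_
    rw [← mul_assoc, neg_mul, Complex.I_mul_I, neg_neg, one_mul]
  obtain ⟨x, hx, hs⟩ := hasSum_aCoeff_mul_of_hasDerivAt
    (f := fun n => aCoeff n * c n / (n : ℝ) ^ (j + 1)) (fun n =>
      div_nonneg (mul_nonneg (aCoeff_nonneg n) (h0 n)) (by positivity))
    (hf ▸ hc.1.aCoeff_mul.div_natCast_pow (j + 1)) (intImDiff_mem he') (intImDiff_apply_zero e)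
    hderiv
  refine ⟨x, hx, (congrArg (HasSum · _) (funext fun n => ?_)).mpr hs⟩
  congr 1
  ring

/-- The odd tail carries a factor x, and dθ/x = du/u, so the last integration is `intZero`; the
single i comes from the odd tail itself. -/
theorem hasSum_aCoeff_sq_div_odd_pow (h0 : ∀ n, 0 ≤ c n)
    (hc : IsBinomialPolylog w fun n => (c n : ℂ)) (j : ℕ) : ∃ x ∈ CMZV 4 (w + j + 2),
      HasSum (fun n : ℕ => ((aCoeff n ^ 2 * c n / (2 * (n : ℝ) + 1) ^ (j + 1) : ℝ) : ℂ))
        (Complex.I / (Real.pi : ℂ) * x) := by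
  obtain ⟨e, he, he0, h⟩ := hc.odd_tail j
  have he' := convLiSpan_le _ he
  have hf : (fun n : ℕ => ((aCoeff n * c n / (2 * (n : ℝ) + 1) ^ (j + 1) : ℝ) : ℂ)) =
      fun n => aCoeff n * c n / (2 * (n : ℂ) + 1) ^ (j + 1) := by
    ext n
    push_cast
    rfl
  have hderiv : ∀ u ∈ Set.Ioo (0 : ℝ) 1, HasDerivAt (powerSum fun n => -Complex.I * intZero e n)
      (2 / (1 + u ^ 2) * powerSum (fun n : ℕ =>
        ((aCoeff n * c n / (2 * (n : ℝ) + 1) ^ (j + 1) : ℝ) : ℂ)) (sinParam u ^ 2)) u := by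
    intro u hu
    have h4 : (u : ℂ) ≠ 0 := by exact_mod_cast hu.1.ne'
    refine (hasDerivAt_powerSum_const_mul (-Complex.I) (hasDerivAt_intZero
      (polyGrowth_of_mem_liSpan he') (abs_lt_one_of_mem_Ioo hu) hu.1.ne')).congr_deriv ?_
    rw [hf, he0, sub_zero, ← mul_div_assoc, ← h u hu]
    simp only [sinParam]
    push_cast
    field_simp
  obtain ⟨x, hx, hs⟩ := hasSum_aCoeff_mul_of_hasDerivAt
    (f := fun n => aCoeff n * c n / (2 * (n : ℝ) + 1) ^ (j + 1)) (fun n =>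
      div_nonneg (mul_nonneg (aCoeff_nonneg n) (h0 n)) (by positivity))
    (hf ▸ hc.1.aCoeff_mul.div_odd_pow (j + 1)) (intZero_mem he') (intZero_apply_zero e)
    hderiv
  refine ⟨x, hx, (congrArg (HasSum · _) (funext fun n => ?_)).mpr hs⟩
  congr 1
  ring

end

theorem mainTheorem3 (k l : List ℕ) (hk : ∀ s ∈ k, 0 < s) (hl : ∀ s ∈ l, 0 < s)
    (p q : ℕ) (hp : 2 ≤ p) (hq : 3 ≤ q) :
    (∃ c ∈ CMZV 4 (k.sum + l.sum + p),
      HasSum (fun n : ℕ => ((aCoeff (n + 1) * (zetaSum k (n + 1) * tSum l (n + 1)) /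
        ((n + 1 : ℕ) : ℝ) ^ p : ℝ) : ℂ)) c) ∧
    (∃ c ∈ CMZV 4 (k.sum + l.sum + q + 1),
      HasSum (fun n : ℕ => ((aCoeff (n + 1) ^ 2 * (zetaSum k (n + 1) * tSum l (n + 1)) /
        ((n + 1 : ℕ) : ℝ) ^ q : ℝ) : ℂ)) (Complex.I / (Real.pi : ℂ) * c)) ∧
    (∃ c ∈ CMZV 4 (k.sum + l.sum + p),
      HasSum (fun n : ℕ => ((aCoeff n * (zetaSum k n * tSum l n) /
        (2 * (n : ℝ) + 1) ^ p : ℝ) : ℂ)) (Complex.I * c)) ∧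
    (∃ c ∈ CMZV 4 (k.sum + l.sum + q + 1),
      HasSum (fun n : ℕ => ((aCoeff n ^ 2 * (zetaSum k n * tSum l n) /
        (2 * (n : ℝ) + 1) ^ q : ℝ) : ℂ)) (Complex.I / (Real.pi : ℂ) * c)) := by
  have h0 : ∀ n, 0 ≤ zetaSum k n * tSum l n := fun n =>
    mul_nonneg (zetaSum_nonneg k n) (tSum_nonneg l n)
  have hc : IsBinomialPolylog (k.sum + l.sum) fun n => ((zetaSum k n * tSum l n : ℝ) : ℂ) := by
    simpa only [Complex.ofReal_mul] using (isBinomialPolylog_mul_and_sum k hk).1 l hl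
  obtain ⟨p, rfl⟩ := Nat.exists_eq_add_of_le' (one_le_two.trans hp)
  obtain ⟨q, rfl⟩ := Nat.exists_eq_add_of_le' ((by norm_num : 1 ≤ 3).trans hq)
  refine ⟨?_, ?_, hasSum_aCoeff_div_odd_pow h0 hc p, hasSum_aCoeff_sq_div_odd_pow h0 hc q⟩
  · obtain ⟨x, hx, hs⟩ := hasSum_aCoeff_div_pow h0 hc p
    refine ⟨x, hx, ?_⟩
    -- The dropped term n = 0 is zero, since its denominator is 0.
    simpa using (hasSum_nat_add_iff' 1).2 hs
  · obtain ⟨x, hx, hs⟩ := hasSum_aCoeff_sq_div_pow h0 hc q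
    refine ⟨x, hx, ?_⟩
    simpa using (hasSum_nat_add_iff' 1).2 hs
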